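/- **Definitions.** A numeration system is a (strictly) increasing sequence $U=(U_n)_{n\ge 0}$ of integers with $U_0=1$ and $C_U:=\sup_n\lceil U_{n+1}/U_n\rceil<\infty$; put $A_U=\{0,\dots,C_U-1\}$. The greedy representation $\mathrm{rep}_U(n)$ of an integer $n\ge 0$ is the unique word $w_{\ell-1}\cdots w_0$ over $A_U$ with $\sum_{i<\ell} w_iU_i=n$, $w_{\ell-1}\ne 0$ if $\ell>0$, and $\sum_{i<j}w_iU_i<U_j$ for $1\le j\le \ell$ (so $\mathrm{rep}_U(0)$ is the empty word). A set $X\subseteq\mathbb N$ is $U$-recognizable if the language $\mathrm{rep}_U(X)$ is regular. A sequence $(x_n)_{n\ge0}$ is $U$-automatic if there is a complete finite deterministic automaton with output, with input alphabet $A_U$, initial state $q_0$, transition function $\delta$ and output function $\tau$, such that $\delta(q_0,0)=q_0$ and $x_n=\tau(\delta(q_0,\mathrm{rep}_U(n)))$ for all $n\ge 0$. For real $\beta>1$, $d_\beta(x)$ is the lexicographically greatest sequence $(x_i)_{i\ge1}$ of natural numbers with $x=\sum_{i\ge1}x_i\beta^{-i}$. If $d_\beta(1)=t_1\cdots t_m0^\omega$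 with $t_m\neq 0$, put $d^*_\beta(1)=(t_1\cdots t_{m-1}(t_m-1))^\omega$; otherwise $d_\beta^*(1)=d_\beta(1)$. The number $\beta$ is a Parry number if $d^*_\beta(1)$ is ultimately periodic; it is a Pisot number if it is an algebraic integer all of whose other conjugates have modulus less than $1$. If $d^*_\beta(1)=t_1t_2\cdots$, the numeration system $U_\beta$ is defined by $U_n=t_1U_{n-1}+\cdots+t_nU_0+1$ for $n\ge 0$; a Parry numeration system is a $U_\beta$ with $\beta$ a Parry number. **Theorem.** Let $U$ be given by $U_n=3U_{n-1}+2U_{n-2}+3U_{n-4}$ for $n\ge4$ and $U_0,U_1,U_2,U_3=1,4,15,54$. 1. $U$ is a Parry numeration system. There is exactly one $\beta>1$ with $U=U_\beta$; it satisfies $|\beta-3.61645|<10^{-5}$, it is a Parry number with $d_\beta(1)=3203\,0^\omega$, and it is not a Pisot number. 2. The characteristic sequence $\mathbf x$ of $\{U_n\mid n\ge0\}$ is $U$-automatic. 3. For every integer $t\ge4$, the set $\{tU_n\mid n\ge0\}$ is not $U$-recognizable. Its characteristic sequence equals $\mu_t(\mathbf x)$, where $\mu_t$ is the uniform substitution $0\mapsto0^t$,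 $1\mapsto10^{t-1}$, and is not $U$-automatic. Hence the class of $U$-automatic sequences is not closed under $\mu_t$. 4. Consequently there is a Parry numeration system $U$ such that the class of $U$-automatic sequences is not closed under taking images by uniform substitutions. -/

import Mathlib

/-! ## Positional numeration systems and greedy representations -/

/-- A positional numeration system: an increasing sequence of integers `U` with `U 0 = 1` and
bounded quotients `⌈U (n + 1) / U n⌉`. -/
structure NumerationSystem where
  seq : ℕ → ℕ
  strictMono_seq : StrictMono seq
  seq_zero : seq 0 = 1
  bddAbove_quot : BddAbove (Set.range fun n : ℕ => ⌈(seq (n + 1) : ℚ) / (seq n : ℚ)⌉₊)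

namespace NumerationSystem

/-- `C_U = sup_n ⌈U (n + 1) / U n⌉`. -/
noncomputable def bound (S : NumerationSystem) : ℕ :=
  ⨆ n : ℕ, ⌈(S.seq (n + 1) : ℚ) / (S.seq n : ℚ)⌉₊

/-- The alphabet `A_U = {0, …, C_U - 1}`. -/
abbrev Digit (S : NumerationSystem) : Type := Fin S.bound

/-- The numerical value of a word of digits, written with the most significant digit first:
`val (w_{ℓ-1} ⋯ w_0) = ∑ w_i U_i`. -/
def val (S : NumerationSystem) : List S.Digit → ℕ
  | [] => 0
  | d :: w => (d : ℕ) * S.seq w.length + S.val w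

/-- `w` is the greedy representation of `n`: it has value `n`, its leading digit is not `0`, and
every suffix `w_{j-1} ⋯ w_0` has value less than `U j`. (For `n = 0` this forces the empty word;
for the empty suffix the last condition reads `0 < U 0`.) -/
structure IsGreedyRep (S : NumerationSystem) (n : ℕ) (w : List S.Digit) : Prop where
  val_eq : S.val w = n
  head_ne : ∀ d ∈ w.head?, (d : ℕ) ≠ 0
  greedy : ∀ v : List S.Digit, v <:+ w → S.val v < S.seq v.length

theorem seq_pos (S : NumerationSystem) (n : ℕ) : 0 < S.seq n := by
  have h := S.strictMono_seq.monotone (Nat.zero_le n)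
  rw [S.seq_zero] at h
  omega

theorem seq_succ_le (S : NumerationSystem) (n : ℕ) : S.seq (n + 1) ≤ S.bound * S.seq n := by
  have h1 : ⌈(S.seq (n + 1) : ℚ) / (S.seq n : ℚ)⌉₊ ≤ S.bound :=
    le_ciSup (f := fun n : ℕ => ⌈(S.seq (n + 1) : ℚ) / (S.seq n : ℚ)⌉₊) S.bddAbove_quot n
  have h2 : (S.seq (n + 1) : ℚ) / (S.seq n : ℚ) ≤ (S.bound : ℚ) :=
    (Nat.le_ceil _).trans (by exact_mod_cast h1)
  have h3 : (0 : ℚ) < (S.seq n : ℚ) := by exact_mod_cast S.seq_pos n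
  rw [div_le_iff₀ h3] at h2
  exact_mod_cast h2

/-- Words of length `l` all of whose suffixes satisfy the greedy condition: there is one for each
integer below `U l`. -/
theorem exists_padded (S : NumerationSystem) (l : ℕ) : ∀ n < S.seq l, ∃ w : List S.Digit,
    w.length = l ∧ S.val w = n ∧ ∀ v : List S.Digit, v <:+ w → S.val v < S.seq v.length := by
  induction l with
  | zero =>
    intro n hn
    rw [S.seq_zero] at hn
    refine ⟨[], rfl, by simp only [val]; omega, ?_⟩
    intro v hv
    rw [List.suffix_nil.mp hv]
    simp [val, S.seq_zero]
  | succ l ih =>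
    intro n hn
    have hp := S.seq_pos l
    obtain ⟨w, hl, hw, hg⟩ := ih (n % S.seq l) (Nat.mod_lt _ hp)
    have hd : n / S.seq l < S.bound := by
      rw [Nat.div_lt_iff_lt_mul hp]
      exact hn.trans_le (S.seq_succ_le l)
    have hv : S.val (⟨n / S.seq l, hd⟩ :: w) = n := by
      simp only [val, hl, hw]
      exact Nat.div_add_mod' n (S.seq l)
    refine ⟨⟨n / S.seq l, hd⟩ :: w, by simp [hl], hv, ?_⟩
    intro v hs
    rcases List.suffix_cons_iff.mp hs with rfl | hs
    · rw [hv]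
      simpa [hl] using hn
    · exact hg v hs

theorem padded_unique (S : NumerationSystem) : ∀ w w' : List S.Digit, w.length = w'.length →
    S.val w = S.val w' → (∀ v : List S.Digit, v <:+ w → S.val v < S.seq v.length) →
    (∀ v : List S.Digit, v <:+ w' → S.val v < S.seq v.length) → w = w' := by
  intro w
  induction w with
  | nil =>
    intro w' hl _ _ _
    exact (List.length_eq_zero_iff.mp hl.symm).symm
  | cons d w ih =>
    intro w' hl hv hg hg'
    cases w' with
    | nil => simp at hl
    | cons d' w' =>
      have hl' : w.length = w'.length := by simpa using hl
      have h1 := hg w (List.suffix_cons d w)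
      have h2 := hg' w' (List.suffix_cons d' w')
      simp only [val, ← hl'] at hv
      rw [← hl'] at h2
      have hp := S.seq_pos w.length
      have e1 : ((d : ℕ) * S.seq w.length + S.val w) / S.seq w.length = d := by
        rw [mul_comm, Nat.mul_add_div hp, Nat.div_eq_of_lt h1, add_zero]
      have e2 : ((d' : ℕ) * S.seq w.length + S.val w') / S.seq w.length = d' := by
        rw [mul_comm, Nat.mul_add_div hp, Nat.div_eq_of_lt h2, add_zero]
      have hd : (d : ℕ) = d' := by rw [← e1, ← e2, hv]
      have hw : S.val w = S.val w' := by
        rw [hd] at hv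
        exact Nat.add_left_cancel hv
      rw [Fin.ext hd, ih w' hl' hw (fun v h => hg v (h.trans (List.suffix_cons d w)))
        (fun v h => hg' v (h.trans (List.suffix_cons d' w')))]

theorem IsGreedyRep.le_val {S : NumerationSystem} {n : ℕ} {d : S.Digit} {w : List S.Digit}
    (h : S.IsGreedyRep n (d :: w)) : S.seq w.length ≤ n := by
  have h0 := h.head_ne d (by simp)
  rw [← h.val_eq]
  simp only [val]
  nlinarith [Nat.pos_of_ne_zero h0, S.seq_pos w.length]

theorem IsGreedyRep.length_le {S : NumerationSystem} {n : ℕ} {w w' : List S.Digit}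
    (h : S.IsGreedyRep n w) (h' : S.IsGreedyRep n w') : w.length ≤ w'.length := by
  cases w with
  | nil => simp
  | cons d w =>
    have h1 := h.le_val
    have h2 := h'.greedy w' List.suffix_rfl
    rw [h'.val_eq] at h2
    have h3 := S.strictMono_seq.lt_iff_lt.mp (h1.trans_lt h2)
    simpa using h3

/-- Every natural number has exactly one greedy representation. -/
theorem existsUnique_isGreedyRep (S : NumerationSystem) (n : ℕ) :
    ∃! w : List S.Digit, S.IsGreedyRep n w := by
  have hex : ∃ l, n < S.seq l := ⟨n + 1, S.strictMono_seq.le_apply (x := n + 1)⟩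
  classical
  obtain ⟨w, hl, hv, hg⟩ := S.exists_padded (Nat.find hex) n (Nat.find_spec hex)
  refine ⟨w, ⟨hv, ?_, hg⟩, ?_⟩
  · intro d hd h0
    cases w with
    | nil => simp at hd
    | cons e w =>
      obtain rfl : e = d := by simpa using hd
      have h1 := hg w (List.suffix_cons e w)
      have h2 : S.val w = n := by simpa [val, h0] using hv
      rw [h2] at h1
      exact Nat.find_min hex (m := w.length) (by rw [← hl]; simp) h1
  · intro w' h'
    refine S.padded_unique w' w ?_ (h'.val_eq.trans hv.symm) h'.greedy hg
    rw [hl]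
    apply le_antisymm
    · cases w' with
      | nil => simp
      | cons d w' =>
        have h1 := h'.le_val
        have h2 := Nat.find_spec hex
        exact S.strictMono_seq.lt_iff_lt.mp (h1.trans_lt h2)
    · apply Nat.find_min'
      have h2 := h'.greedy w' List.suffix_rfl
      rwa [h'.val_eq] at h2

/-- The greedy representation `rep_U(n)`, a word over `A_U`. -/
noncomputable def rep (S : NumerationSystem) (n : ℕ) : List S.Digit :=
  (S.existsUnique_isGreedyRep n).exists.choose

theorem isGreedyRep_rep (S : NumerationSystem) (n : ℕ) : S.IsGreedyRep n (S.rep n) :=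
  (S.existsUnique_isGreedyRep n).exists.choose_spec

/-- The language `rep_U(X)`. -/
def repLanguage (S : NumerationSystem) (X : Set ℕ) : Language S.Digit :=
  {w | ∃ n ∈ X, S.rep n = w}

/-- `X` is `U`-recognizable if `rep_U(X)` is accepted by a finite automaton. -/
def IsRecognizable (S : NumerationSystem) (X : Set ℕ) : Prop :=
  (S.repLanguage X).IsRegular

end NumerationSystem

/-! ## Automatic sequences and uniform substitutions -/

/-- A complete deterministic automaton with output, with input alphabet `A`, state set `Q` and
output alphabet `B`. -/
structure DFAO (A Q B : Type*) where
  start : Q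
  step : Q → A → Q
  output : Q → B

/-- The output of the automaton after reading a word from left to right. -/
def DFAO.eval {A Q B : Type*} (M : DFAO A Q B) (w : List A) : B :=
  M.output (w.foldl M.step M.start)

/-- `x` is a `U`-automatic sequence. -/
def IsAutomatic (S : NumerationSystem) {B : Type} (x : ℕ → B) : Prop :=
  ∃ (Q : Type) (_ : Finite Q) (M : DFAO S.Digit Q B),
    (∀ a : S.Digit, (a : ℕ) = 0 → M.step M.start a = M.start) ∧
    ∀ n : ℕ, x n = M.eval (S.rep n)

/-- The image of the infinite word `x` under the uniform substitution of length `l` that maps the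
letter `b` to the word `μ b 0, μ b 1, …, μ b (l - 1)`. -/
def substImage {B C : Type} {l : ℕ} (hl : 0 < l) (μ : B → Fin l → C) (x : ℕ → B) : ℕ → C :=
  fun n => μ (x (n / l)) ⟨n % l, Nat.mod_lt n hl⟩

/-- The class of `U`-automatic sequences is closed under the uniform substitution `μ`. -/
def ClosedUnderSubst (S : NumerationSystem) {B C : Type} {l : ℕ} (hl : 0 < l)
    (μ : B → Fin l → C) : Prop :=
  ∀ x : ℕ → B, IsAutomatic S x → IsAutomatic S (substImage hl μ x)

/-- The class of `U`-automatic sequences is closed under taking images by uniform substitutions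
between finite alphabets. -/
def ClosedUnderUniformSubst (S : NumerationSystem) : Prop :=
  ∀ (B C : Type) [Finite B] [Finite C] (l : ℕ) (hl : 0 < l) (μ : B → Fin l → C),
    ClosedUnderSubst S hl μ

open Classical in
/-- The characteristic sequence of a set of natural numbers. -/
noncomputable def charSeq (X : Set ℕ) : ℕ → Fin 2 :=
  fun n => if n ∈ X then 1 else 0

/-- The substitution `0 ↦ 0^t`, `1 ↦ 1 0^(t-1)`. -/
def spread (t : ℕ) : Fin 2 → Fin t → Fin 2 :=
  fun a i => if a = 1 ∧ (i : ℕ) = 0 then 1 else 0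

/-! ## Expansions in a real base, Parry and Pisot numbers

The digit sequence `x_1 x_2 x_3 ⋯` is stored as `d 0, d 1, d 2, …`. -/

/-- `d` is the `β`-expansion of `x`: the lexicographically greatest sequence of natural numbers
with `x = ∑_{i ≥ 1} x_i β^{-i}`. -/
def IsBetaExpansion (β x : ℝ) (d : ℕ → ℕ) : Prop :=
  HasSum (fun i : ℕ => (d i : ℝ) / β ^ (i + 1)) x ∧
  ∀ d' : ℕ → ℕ, HasSum (fun i : ℕ => (d' i : ℝ) / β ^ (i + 1)) x → toLex d' ≤ toLex d

/-- `m` is the (zero-based) position of the last nonzero digit of `d`. -/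
def IsLastNonzero (d : ℕ → ℕ) (m : ℕ) : Prop :=
  d m ≠ 0 ∧ ∀ i, m < i → d i = 0

open Classical in
/-- The passage from `d_β(1)` to `d_β^*(1)`: a finite expansion `t_1 ⋯ t_m 0^ω` with `t_m ≠ 0` is
replaced by `(t_1 ⋯ t_{m-1} (t_m - 1))^ω`, any other sequence is kept. -/
noncomputable def quasiGreedy (d : ℕ → ℕ) : ℕ → ℕ :=
  if h : ∃ m, IsLastNonzero d m then
    fun i => if i % (h.choose + 1) = h.choose then d h.choose - 1 else d (i % (h.choose + 1))
  else d

/-- Ultimately periodic sequences. -/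
def UltimatelyPeriodic (d : ℕ → ℕ) : Prop :=
  ∃ N p : ℕ, 0 < p ∧ ∀ n, N ≤ n → d (n + p) = d n

/-- `β > 1` is a Parry number: `d_β^*(1)` is ultimately periodic. -/
def IsParryNumber (β : ℝ) : Prop :=
  1 < β ∧ ∃ d : ℕ → ℕ, IsBetaExpansion β 1 d ∧ UltimatelyPeriodic (quasiGreedy d)

/-- `β` is a Pisot number: an algebraic integer `β > 1` all of whose other conjugates have modulus
less than `1`. -/
def IsPisotNumber (β : ℝ) : Prop :=
  1 < β ∧ IsIntegral ℤ β ∧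
    ∀ z : ℂ, Polynomial.aeval z (minpoly ℚ β) = 0 → z ≠ (β : ℂ) → ‖z‖ < 1

/-- `U = U_β`: with `d_β^*(1) = t_1 t_2 ⋯`, one has `U_n = t_1 U_{n-1} + ⋯ + t_n U_0 + 1` for all
`n ≥ 0`. -/
def IsCanonicalSystem (β : ℝ) (S : NumerationSystem) : Prop :=
  ∃ d : ℕ → ℕ, IsBetaExpansion β 1 d ∧
    ∀ n : ℕ, S.seq n = ∑ i ∈ Finset.range n, quasiGreedy d i * S.seq (n - 1 - i) + 1

/-- `U` is a Parry numeration system. -/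
def IsParrySystem (S : NumerationSystem) : Prop :=
  ∃ β : ℝ, IsParryNumber β ∧ IsCanonicalSystem β S

/-! ## The numeration system of the theorem -/

/-- `U_n = 3 U_{n-1} + 2 U_{n-2} + 3 U_{n-4}` with `U_0, …, U_3 = 1, 4, 15, 54`. -/
def exampleSeq : ℕ → ℕ
  | 0 => 1
  | 1 => 4
  | 2 => 15
  | 3 => 54
  | n + 4 => 3 * exampleSeq (n + 3) + 2 * exampleSeq (n + 2) + 3 * exampleSeq n

theorem exampleSeq_growth (n : ℕ) : 3 * exampleSeq n < exampleSeq (n + 1) ∧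
    exampleSeq (n + 1) ≤ 4 * exampleSeq n := by
  induction n using Nat.strong_induction_on with
  | _ n ih =>
    match n, ih with
    | 0, _ => decide
    | 1, _ => decide
    | 2, _ => decide
    | n + 3, ih =>
      have h0 := ih n (by omega)
      have h1 := ih (n + 1) (by omega)
      have h2 := ih (n + 2) (by omega)
      have e : exampleSeq (n + 3 + 1) =
        3 * exampleSeq (n + 3) + 2 * exampleSeq (n + 2) + 3 * exampleSeq n := rfl
      rw [e]
      simp only [Nat.add_assoc, Nat.reduceAdd] at h0 h1 h2 ⊢
      omega

/-- The numeration system given by `exampleSeq`. -/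
def exampleSystem : NumerationSystem where
  seq := exampleSeq
  strictMono_seq := strictMono_nat_of_lt_succ fun n => by
    have h := exampleSeq_growth n
    omega
  seq_zero := rfl
  bddAbove_quot := by
    refine ⟨4, ?_⟩
    rintro _ ⟨n, rfl⟩
    have h := exampleSeq_growth n
    have hp : (0 : ℚ) < (exampleSeq n : ℚ) := by
      have : 0 < exampleSeq n := by omega
      exact_mod_cast this
    refine Nat.ceil_le.mpr ?_
    rw [div_le_iff₀ hp]
    exact_mod_cast h.2

/-- The sequence `3203 0^ω`. -/
def expansion3203 : ℕ → ℕ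
  | 0 => 3
  | 1 => 2
  | 2 => 0
  | 3 => 3
  | _ + 4 => 0

/-! The characteristic polynomial is irreducible, and besides the dominant root `β` it has a real
root `x ≈ -1.0968`. This conjugate of modulus greater than 1 excludes the Pisot property and also
defeats finite automata.

For fixed `t`, the leading digits of the representation of `t * U n` stabilize as `n` grows, because
an integer sequence satisfying the recurrence has eventually constant sign
(`LinRec.eventually_nonneg_or_neg`, `IsStablePrefix.extend`). A stable prefix `u` of `t * U (m + a)`
with `m` digits missing leaves a remainder which, as a function of `m`, satisfies the recurrence
again. Its component at the root `x` is, up to a nonzero constant, the defect `t * x ^ a - u(x)`.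

Suppose two stable prefixes lead an automaton to the same state. Appending the smaller remainder to
the other prefix gives a greedy word, which is accepted and so represents some `t * U k`. The gaps
between these numbers force the two remainders to be equal for all large `m`. Hence the state
determines the defect (`defect_eq_of_foldl_eq`), and a finite automaton allows only finitely many
defects.

On the other hand, one more digit `d ≤ 3` changes the defect `y` into `x * y - d`. With `B = 3 / (x
^ 2 - 1)`, all these maps push points outside `[x * B, B]` further away, so a single defect outside
this interval makes the defects unbounded (`defect_unbounded`). For `t ≥ 29` a size estimate at the
units digit provides one; for `4 ≤ t < 29` explicit prefixes do. -/

/-! ## The characteristic polynomial -/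

open Polynomial in
/-- The characteristic polynomial of `exampleSeq`. -/
noncomputable def exampleCharpoly : ℤ[X] := X ^ 4 - 3 * X ^ 3 - 2 * X ^ 2 - 3

open Polynomial in
theorem exampleCharpoly_natDegree : exampleCharpoly.natDegree = 4 := by
  unfold exampleCharpoly; compute_degree!

open Polynomial in
theorem exampleCharpoly_monic : exampleCharpoly.Monic := by
  unfold exampleCharpoly; monicity!

open Polynomial in
-- A linear factor would give an integer root dividing 3. For two quadratic factors the constant
-- terms multiply to -3, which leaves finitely many cases.
theorem exampleCharpoly_irreducible : Irreducible exampleCharpoly := by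
  have hne : exampleCharpoly ≠ 1 := by
    intro h
    have := exampleCharpoly_natDegree
    rw [h] at this
    simp at this
  rw [exampleCharpoly_monic.irreducible_iff_natDegree']
  refine ⟨hne, ?_⟩
  intro f g hf hg hfg hdeg
  have hg2 : g.natDegree = 1 ∨ g.natDegree = 2 := by
    rw [exampleCharpoly_natDegree, Finset.mem_Ioc] at hdeg
    omega
  have hsum : f.natDegree + g.natDegree = 4 := by
    rw [← hf.natDegree_mul hg, hfg, exampleCharpoly_natDegree]
  have hc : ∀ n, (f * g).coeff n = exampleCharpoly.coeff n := fun n => by rw [hfg]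
  rcases hg2 with h | h
  · have hf3 : f.natDegree = 3 := by omega
    have ef := hf.as_sum
    have eg := hg.as_sum
    rw [hf3] at ef
    rw [h] at eg
    have key : ∀ x : ℤ, (x ^ 3 + (f.coeff 0 + f.coeff 1 * x + f.coeff 2 * x ^ 2)) *
        (x + g.coeff 0) = x ^ 4 - 3 * x ^ 3 - 2 * x ^ 2 - 3 := by
      intro x
      have h1 := congrArg (Polynomial.eval x) hfg
      rw [ef, eg] at h1
      simpa [exampleCharpoly, Finset.sum_range_succ, eval_mul] using h1
    have k := key (-(g.coeff 0))
    generalize g.coeff 0 = a at k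
    have hd : a ∣ 3 := ⟨a ^ 3 + 3 * a ^ 2 - 2 * a, by linear_combination k⟩
    have hle := Int.le_of_dvd (by norm_num) hd
    have hle' := Int.le_of_dvd (by norm_num) ((neg_dvd).mpr hd)
    have : -3 ≤ a := by linarith
    interval_cases a <;> norm_num at k
  · have hf3 : f.natDegree = 2 := by omega
    have ef := hf.as_sum
    have eg := hg.as_sum
    rw [hf3] at ef
    rw [h] at eg
    have key : ∀ x : ℤ, (x ^ 2 + (f.coeff 0 + f.coeff 1 * x)) *
        (x ^ 2 + (g.coeff 0 + g.coeff 1 * x)) = x ^ 4 - 3 * x ^ 3 - 2 * x ^ 2 - 3 := by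
      intro x
      have h1 := congrArg (Polynomial.eval x) hfg
      rw [ef, eg] at h1
      simpa [exampleCharpoly, Finset.sum_range_succ, eval_mul] using h1
    -- Four values suffice to recover the four lower coefficients of a monic quartic.
    have k0 := key 0
    have k1 := key 1
    have k2 := key (-1)
    have k3 := key 2
    generalize g.coeff 0 = d at *
    generalize g.coeff 1 = c at *
    generalize f.coeff 0 = b at *
    generalize f.coeff 1 = a at *
    clear key ef eg hc hfg
    have e0 : b * d = -3 := by linear_combination k0
    have e1 : a * d + b * c = 0 := by linarith
    have e3 : a + c = -3 := by linarith
    have hd : d ∣ 3 := ⟨-b, by linarith⟩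
    have hle := Int.le_of_dvd (by norm_num) hd
    have hle' := Int.le_of_dvd (by norm_num) ((neg_dvd).mpr hd)
    have : -3 ≤ d := by linarith
    have hc : c = -3 - a := by linarith
    subst hc
    interval_cases d
    · obtain rfl : b = 1 := by omega
      omega
    · omega
    · obtain rfl : b = 3 := by omega
      omega
    · omega
    · obtain rfl : b = -3 := by omega
      omega
    · omega
    · obtain rfl : b = -1 := by omega
      omega

/-- The roots of the characteristic polynomial. -/
def IsCharRoot (x : ℝ) : Prop := x ^ 4 = 3 * x ^ 3 + 2 * x ^ 2 + 3

theorem exists_isCharRoot {a b : ℝ} (hab : a ≤ b)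
    (h : (a ^ 4 - 3 * a ^ 3 - 2 * a ^ 2 - 3) * (b ^ 4 - 3 * b ^ 3 - 2 * b ^ 2 - 3) < 0) :
    ∃ x ∈ Set.Ioo a b, IsCharRoot x := by
  have hc : ContinuousOn (fun x : ℝ => x ^ 4 - 3 * x ^ 3 - 2 * x ^ 2 - 3) (Set.Icc a b) := by
    fun_prop
  rcases mul_neg_iff.mp h with h | h
  · obtain ⟨x, hx, h0⟩ := intermediate_value_Ioo' hab hc ⟨h.2, h.1⟩
    exact ⟨x, hx, by unfold IsCharRoot; simp only at h0; linarith⟩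
  · obtain ⟨x, hx, h0⟩ := intermediate_value_Ioo hab hc ⟨h.1, h.2⟩
    exact ⟨x, hx, by unfold IsCharRoot; simp only at h0; linarith⟩

theorem exists_dominant_root : ∃ x : ℝ, IsCharRoot x ∧ 3.616445 < x ∧ x < 3.616455 := by
  obtain ⟨x, hx, h⟩ := exists_isCharRoot (a := 3.616445) (b := 3.616455) (by norm_num) (by norm_num)
  exact ⟨x, h, hx.1, hx.2⟩

theorem exists_negative_root : ∃ x : ℝ, IsCharRoot x ∧ -1.09685 < x ∧ x < -1.09684 := by
  obtain ⟨x, hx, h⟩ := exists_isCharRoot (a := -1.09685) (b := -1.09684) (by norm_num) (by norm_num)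
  exact ⟨x, h, hx.1, hx.2⟩

/-- Division by `x ^ 4` turns the equation into `1 = 3 / x + 2 / x ^ 2 + 3 / x ^ 4`, whose right
side is strictly decreasing for `x > 0`. -/
theorem IsCharRoot.unique_pos {x y : ℝ} (hx : IsCharRoot x) (hy : IsCharRoot y) (hx0 : 0 < x)
    (hy0 : 0 < y) : x = y := by
  have key : ∀ {x y : ℝ}, IsCharRoot x → IsCharRoot y → 0 < x → ¬ x < y := by
    intro x y hx hy hx0 hlt
    unfold IsCharRoot at hx hy
    have hy0 := hx0.trans hlt
    have e : 3 * (x * y) ^ 3 * (y - x) + 2 * (x * y) ^ 2 * ((y - x) * (y + x)) +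
        3 * ((y - x) * (y + x) * (y ^ 2 + x ^ 2)) = 0 := by
      linear_combination x ^ 4 * hy - y ^ 4 * hx
    have hs : 0 < y - x := sub_pos.mpr hlt
    have : 0 < 3 * (x * y) ^ 3 * (y - x) + 2 * (x * y) ^ 2 * ((y - x) * (y + x)) +
        3 * ((y - x) * (y + x) * (y ^ 2 + x ^ 2)) := by positivity
    linarith
  exact le_antisymm (not_lt.mp (key hy hx hy0)) (not_lt.mp (key hx hy hx0))

open Polynomial in
theorem exampleCharpoly_aeval {A : Type*} [CommRing A] [Algebra ℤ A] (x : A) :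
    aeval x exampleCharpoly = x ^ 4 - 3 * x ^ 3 - 2 * x ^ 2 - 3 := by
  simp [exampleCharpoly, map_ofNat]

open Polynomial in
theorem IsCharRoot.minpoly_eq {x : ℝ} (hx : IsCharRoot x) :
    minpoly ℚ x = exampleCharpoly.map (Int.castRingHom ℚ) := by
  have hirr : Irreducible (exampleCharpoly.map (Int.castRingHom ℚ)) :=
    (IsPrimitive.Int.irreducible_iff_irreducible_map_cast exampleCharpoly_monic.isPrimitive).mp
      exampleCharpoly_irreducible
  refine (minpoly.eq_of_irreducible_of_monic hirr ?_ (exampleCharpoly_monic.map _)).symm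
  have : aeval x exampleCharpoly = 0 := by
    rw [exampleCharpoly_aeval, hx]; ring
  rw [← this]
  exact Polynomial.aeval_map_algebraMap ℚ x exampleCharpoly

open Polynomial in
-- By irreducibility the negative root, of modulus greater than 1, is a conjugate.
theorem IsCharRoot.not_isPisotNumber {x : ℝ} (hx : IsCharRoot x) (h1 : 1 < x) :
    ¬ IsPisotNumber x := by
  rintro ⟨-, -, h⟩
  obtain ⟨g, hg, hg1, hg2⟩ := exists_negative_root
  have h2 := h (g : ℂ) ?_ ?_
  · rw [Complex.norm_real, Real.norm_eq_abs, abs_lt] at h2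
    linarith [h2.1]
  · rw [hx.minpoly_eq]
    have h3 : aeval (g : ℂ) (exampleCharpoly.map (algebraMap ℤ ℚ)) = 0 := by
      rw [Polynomial.aeval_map_algebraMap, exampleCharpoly_aeval]
      have : ((g ^ 4 : ℝ) : ℂ) = ((3 * g ^ 3 + 2 * g ^ 2 + 3 : ℝ) : ℂ) := by rw [hg]
      push_cast at this
      rw [this]; ring
    exact h3
  · intro h4
    have : g = x := by exact_mod_cast h4
    linarith

open Polynomial in
/-- The powers `1, x, x ^ 2, x ^ 3` of a root are linearly independent over the rationals. -/
theorem IsCharRoot.coeff_eq_zero {x : ℝ} (hx : IsCharRoot x) {a b c d : ℚ}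
    (h : (a : ℝ) + b * x + c * x ^ 2 + d * x ^ 3 = 0) : a = 0 ∧ b = 0 ∧ c = 0 ∧ d = 0 := by
  set p : ℚ[X] := C a + C b * X + C c * X ^ 2 + C d * X ^ 3 with hp
  have hp0 : p = 0 := by
    by_contra hne
    have h1 := natDegree_le_natDegree (minpoly.degree_le_of_ne_zero ℚ x hne (by simpa [hp] using h))
    rw [hx.minpoly_eq, (exampleCharpoly_monic).natDegree_map, exampleCharpoly_natDegree] at h1
    have h2 : p.natDegree ≤ 3 := by rw [hp]; compute_degree
    omega
  have hc : ∀ n, p.coeff n = 0 := fun n => by rw [hp0]; simp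
  have c0 := hc 0
  have c1 := hc 1
  have c2 := hc 2
  have c3 := hc 3
  simp [hp, coeff_X, coeff_C] at c0 c1 c2 c3
  exact ⟨c0, c1, c2, c3⟩

/-! ## The canonical system of a base -/

/-- In the finite case, lowering the last digit makes one period contribute `1 - β ^ (-(m + 1))`. So
the sum `s` satisfies `s = 1 - β ^ (-(m + 1)) + β ^ (-(m + 1)) * s`, which gives `s = 1`. -/
theorem IsBetaExpansion.hasSum_quasiGreedy {β : ℝ} (hβ : 1 < β) {d : ℕ → ℕ}
    (h : IsBetaExpansion β 1 d)
    (hs : Summable fun i : ℕ => (quasiGreedy d i : ℝ) / β ^ (i + 1)) :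
    HasSum (fun i : ℕ => (quasiGreedy d i : ℝ) / β ^ (i + 1)) 1 := by
  by_cases hm : ∃ m, IsLastNonzero d m
  · have hq : quasiGreedy d = fun i =>
        if i % (hm.choose + 1) = hm.choose then d hm.choose - 1 else d (i % (hm.choose + 1)) := by
      rw [quasiGreedy, dif_pos hm]
    obtain ⟨hm1, hm2⟩ := hm.choose_spec
    generalize hm.choose = m at hq hm1 hm2
    have h1 : ∑ i ∈ Finset.range (m + 1), (d i : ℝ) / β ^ (i + 1) = 1 := by
      refine (hasSum_sum_of_ne_finset_zero ?_).unique h.1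
      intro i hi
      rw [hm2 i (by simpa using hi)]
      simp
    have h2 : ∑ i ∈ Finset.range (m + 1), (quasiGreedy d i : ℝ) / β ^ (i + 1) =
        1 - (β ^ (m + 1))⁻¹ := by
      rw [← h1, Finset.sum_range_succ, Finset.sum_range_succ]
      have h3 : ∀ i ∈ Finset.range m, (quasiGreedy d i : ℝ) / β ^ (i + 1) =
          (d i : ℝ) / β ^ (i + 1) := by
        intro i hi
        have hi' := Finset.mem_range.mp hi
        simp only [hq]
        rw [Nat.mod_eq_of_lt (by omega), if_neg (by omega)]
      rw [Finset.sum_congr rfl h3]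
      have h4 : quasiGreedy d m = d m - 1 := by
        simp only [hq]
        rw [Nat.mod_eq_of_lt (by omega), if_pos rfl]
      rw [h4, Nat.cast_sub (by omega)]
      push_cast
      ring
    have hper : ∀ i, quasiGreedy d (i + (m + 1)) = quasiGreedy d i := by
      intro i
      simp only [hq, Nat.add_mod_right]
    have h5 := hs.sum_add_tsum_nat_add (m + 1)
    have h6 : ∀ i : ℕ, (quasiGreedy d (i + (m + 1)) : ℝ) / β ^ (i + (m + 1) + 1) =
        (quasiGreedy d i : ℝ) / β ^ (i + 1) * (β ^ (m + 1))⁻¹ := by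
      intro i
      rw [hper]
      field_simp
      ring
    simp only [h6, h2, tsum_mul_right] at h5
    have h7 : (β ^ (m + 1))⁻¹ < 1 := inv_lt_one_of_one_lt₀ (one_lt_pow₀ hβ (by omega))
    have h8 : ∑' i : ℕ, (quasiGreedy d i : ℝ) / β ^ (i + 1) = 1 := by
      have h9 : (1 - (β ^ (m + 1))⁻¹) *
          (∑' i : ℕ, (quasiGreedy d i : ℝ) / β ^ (i + 1) - 1) = 0 := by linear_combination -h5
      rcases mul_eq_zero.mp h9 with h | h <;> linarith
    rw [← h8]
    exact hs.hasSum
  · have hq : quasiGreedy d = d := by rw [quasiGreedy, dif_neg hm]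
    rw [hq]
    exact h.1

theorem isLastNonzero_expansion3203 {m : ℕ} : IsLastNonzero expansion3203 m ↔ m = 3 := by
  constructor
  · rintro ⟨h1, h2⟩
    rcases lt_trichotomy m 3 with h | h | h
    · have := h2 3 h
      simp [expansion3203] at this
    · exact h
    · obtain ⟨k, rfl⟩ := Nat.exists_eq_add_of_le' h
      simp [expansion3203] at h1
  · rintro rfl
    refine ⟨by simp [expansion3203], ?_⟩
    intro i hi
    obtain ⟨k, rfl⟩ := Nat.exists_eq_add_of_le' hi
    rfl

theorem quasiGreedy_expansion3203 : quasiGreedy expansion3203 = fun i =>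
    if i % 4 = 3 then 2 else expansion3203 (i % 4) := by
  have h : ∃ m, IsLastNonzero expansion3203 m := ⟨3, isLastNonzero_expansion3203.mpr rfl⟩
  have h3 : h.choose = 3 := isLastNonzero_expansion3203.mp h.choose_spec
  rw [quasiGreedy, dif_pos h, h3]
  rfl

theorem quasiGreedy_expansion3203_add_four (i : ℕ) :
    quasiGreedy expansion3203 (i + 4) = quasiGreedy expansion3203 i := by
  simp [quasiGreedy_expansion3203]

theorem quasiGreedy_expansion3203_le (i : ℕ) : quasiGreedy expansion3203 i ≤ 3 := by
  have h : i % 4 < 4 := Nat.mod_lt _ (by norm_num)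
  simp only [quasiGreedy_expansion3203]
  generalize i % 4 = j at h
  interval_cases j <;> simp [expansion3203]

/-- Induction in steps of four: the first period `3202` contributes `3 U (n+3) + 2 U (n+2) + 2 U n`,
and the later terms together with the final 1 amount to one more `U n`. -/
theorem exampleSeq_eq_sum (n : ℕ) : exampleSeq n =
    ∑ i ∈ Finset.range n, quasiGreedy expansion3203 i * exampleSeq (n - 1 - i) + 1 := by
  have q0 : quasiGreedy expansion3203 0 = 3 := by simp [quasiGreedy_expansion3203, expansion3203]
  have q1 : quasiGreedy expansion3203 1 = 2 := by simp [quasiGreedy_expansion3203, expansion3203]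
  have q2 : quasiGreedy expansion3203 2 = 0 := by simp [quasiGreedy_expansion3203, expansion3203]
  have q3 : quasiGreedy expansion3203 3 = 2 := by simp [quasiGreedy_expansion3203]
  induction n using Nat.strong_induction_on with
  | _ n ih =>
    match n, ih with
    | 0, _ => simp [exampleSeq]
    | 1, _ => simp [exampleSeq, q0]
    | 2, _ => simp [exampleSeq, q0, q1, Finset.sum_range_succ]
    | 3, _ => simp [exampleSeq, q0, q1, q2, Finset.sum_range_succ]
    | n + 4, ih =>
      have h := ih n (by omega)
      rw [Finset.sum_range_succ', Finset.sum_range_succ', Finset.sum_range_succ',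
        Finset.sum_range_succ']
      simp only [Nat.add_assoc, Nat.reduceAdd, quasiGreedy_expansion3203_add_four, q0, q1, q2, q3,
        zero_add]
      have h2 : ∀ i, n + 4 - 1 - (i + 4) = n - 1 - i := fun i => by omega
      simp only [h2]
      have e : exampleSeq (n + 4) =
        3 * exampleSeq (n + 3) + 2 * exampleSeq (n + 2) + 3 * exampleSeq n := rfl
      have e1 : n + 4 - 1 - 0 = n + 3 := by omega
      have e2 : n + 4 - 1 - 1 = n + 2 := by omega
      have e3 : n + 4 - 1 - 3 = n := by omega
      rw [e, e1, e2, e3]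
      omega

theorem hasSum_expansion3203 {β : ℝ} (hβ : IsCharRoot β) (h1 : 1 < β) :
    HasSum (fun i : ℕ => (expansion3203 i : ℝ) / β ^ (i + 1)) 1 := by
  have hs : ∑ i ∈ Finset.range 4, (expansion3203 i : ℝ) / β ^ (i + 1) = 1 := by
    have h0 : β ≠ 0 := by linarith
    have e := hβ
    unfold IsCharRoot at e
    norm_num [Finset.sum_range_succ, expansion3203]
    field_simp
    linarith
  refine hs ▸ hasSum_sum_of_ne_finset_zero ?_
  intro i hi
  obtain ⟨k, rfl⟩ := Nat.exists_eq_add_of_le' (not_lt.mp (Finset.mem_range.not.mp hi))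
  simp [expansion3203]

/-- If a sequence is lexicographically larger and first differs at `k`, its partial sum through `k`
already exceeds 1. For `k < 4` this follows from the equation of `β` and `β < 4`; for `k ≥ 4` the
digits before `k` already sum to 1. -/
theorem isBetaExpansion_expansion3203 {β : ℝ} (hβ : IsCharRoot β) (h3 : 3 < β) :
    IsBetaExpansion β 1 expansion3203 := by
  have h0 : 0 < β := by linarith
  refine ⟨hasSum_expansion3203 hβ (by linarith), ?_⟩
  intro d hd
  by_contra hlt
  obtain ⟨k, hk1, hk2⟩ : ∃ k, (∀ j, j < k → expansion3203 j = d j) ∧ expansion3203 k < d k :=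
    not_le.mp hlt
  have hle := sum_le_hasSum (Finset.range (k + 1)) (fun i _ => by positivity) hd
  have hpre : ∑ i ∈ Finset.range k, (expansion3203 i : ℝ) / β ^ (i + 1) =
      ∑ i ∈ Finset.range k, (d i : ℝ) / β ^ (i + 1) :=
    Finset.sum_congr rfl fun i hi => by rw [hk1 i (Finset.mem_range.mp hi)]
  rw [Finset.sum_range_succ, ← hpre] at hle
  have hk3 : (expansion3203 k : ℝ) + 1 ≤ d k := by exact_mod_cast hk2
  have hk4 : ((expansion3203 k : ℝ) + 1) / β ^ (k + 1) ≤ d k / β ^ (k + 1) := by gcongr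
  have e := hβ
  unfold IsCharRoot at e
  have key : 1 < ∑ i ∈ Finset.range k, (expansion3203 i : ℝ) / β ^ (i + 1) +
      ((expansion3203 k : ℝ) + 1) / β ^ (k + 1) := by
    rcases Nat.lt_or_ge k 4 with h | h
    · have hβ4 : β < 4 := by
        by_contra h4
        nlinarith [pow_pos h0 3, pow_pos h0 2, mul_le_mul_of_nonneg_right (not_lt.mp h4)
          (pow_pos h0 3).le, mul_le_mul_of_nonneg_right (not_lt.mp h4) (pow_pos h0 2).le]
      interval_cases k <;>
        norm_num [Finset.sum_range_succ, expansion3203] <;> field_simp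
      · linarith
      · nlinarith
      · nlinarith [pow_pos h0 2]
      · nlinarith [pow_pos h0 3]
    · have hs : ∑ i ∈ Finset.range k, (expansion3203 i : ℝ) / β ^ (i + 1) = 1 := by
        refine (hasSum_sum_of_ne_finset_zero ?_).unique (hasSum_expansion3203 hβ (by linarith))
        intro i hi
        obtain ⟨j, rfl⟩ := Nat.exists_eq_add_of_le'
          (h.trans (not_lt.mp (Finset.mem_range.not.mp hi)))
        simp [expansion3203]
      rw [hs]
      have : 0 < ((expansion3203 k : ℝ) + 1) / β ^ (k + 1) := by positivity
      linarith
  linarith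

theorem isParryNumber_of_isCharRoot {β : ℝ} (hβ : IsCharRoot β) (h3 : 3 < β) : IsParryNumber β :=
  ⟨by linarith, expansion3203, isBetaExpansion_expansion3203 hβ h3, 0, 4, by norm_num,
    fun n _ => quasiGreedy_expansion3203_add_four n⟩

theorem isCanonicalSystem_of_isCharRoot {β : ℝ} (hβ : IsCharRoot β) (h3 : 3 < β) :
    IsCanonicalSystem β exampleSystem :=
  ⟨expansion3203, isBetaExpansion_expansion3203 hβ h3, exampleSeq_eq_sum⟩

/-- The digits `t_i` in `U_n = t_1 U_{n-1} + ⋯ + t_n U_0 + 1` are determined by `U`. -/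
theorem digits_unique {S : NumerationSystem} {a b : ℕ → ℕ}
    (ha : ∀ n, S.seq n = ∑ i ∈ Finset.range n, a i * S.seq (n - 1 - i) + 1)
    (hb : ∀ n, S.seq n = ∑ i ∈ Finset.range n, b i * S.seq (n - 1 - i) + 1) : a = b := by
  funext n
  induction n using Nat.strong_induction_on with
  | _ n ih =>
    have h := (ha (n + 1)).symm.trans (hb (n + 1))
    rw [Finset.sum_range_succ, Finset.sum_range_succ,
      Finset.sum_congr rfl fun i hi => by rw [ih i (Finset.mem_range.mp hi)]] at h
    have e : n + 1 - 1 - n = 0 := by omega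
    rw [e, S.seq_zero] at h
    omega

/-- `U` determines the quasi-greedy digits, so they are `(3202)^ω`. Splitting off one period from
their sum 1 yields the characteristic equation. -/
theorem isCharRoot_of_isCanonicalSystem {β : ℝ} (h1 : 1 < β)
    (h : IsCanonicalSystem β exampleSystem) : IsCharRoot β := by
  obtain ⟨d, hd, hU⟩ := h
  have hq : quasiGreedy d = quasiGreedy expansion3203 := digits_unique hU exampleSeq_eq_sum
  have h0 : 0 < β := by linarith
  have hs : Summable fun i : ℕ => (quasiGreedy d i : ℝ) / β ^ (i + 1) := by
    have hg : Summable fun i : ℕ => 3 * (β⁻¹) ^ (i + 1) :=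
      ((summable_nat_add_iff 1).mpr (summable_geometric_of_lt_one (by positivity)
        (inv_lt_one_of_one_lt₀ h1))).mul_left 3
    refine Summable.of_nonneg_of_le (fun i => by positivity) (fun i => ?_) hg
    rw [inv_pow, ← div_eq_mul_inv, hq]
    have : (quasiGreedy expansion3203 i : ℝ) ≤ 3 := by
      exact_mod_cast quasiGreedy_expansion3203_le i
    gcongr
  have hsum := hd.hasSum_quasiGreedy h1 hs
  have h5 := hs.sum_add_tsum_nat_add 4
  have h6 : ∀ i : ℕ, (quasiGreedy d (i + 4) : ℝ) / β ^ (i + 4 + 1) =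
      (quasiGreedy d i : ℝ) / β ^ (i + 1) * (β ^ 4)⁻¹ := by
    intro i
    rw [hq, quasiGreedy_expansion3203_add_four]
    field_simp
    ring
  simp only [h6, tsum_mul_right, hsum.tsum_eq] at h5
  rw [hq] at h5
  simp only [Finset.sum_range_succ, Finset.sum_range_zero, quasiGreedy_expansion3203] at h5
  norm_num [expansion3203] at h5
  field_simp at h5
  unfold IsCharRoot
  linarith

theorem IsCanonicalSystem.base_unique {β β' : ℝ} (h1 : 1 < β) (h1' : 1 < β')
    (h : IsCanonicalSystem β exampleSystem) (h' : IsCanonicalSystem β' exampleSystem) : β' = β :=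
  (isCharRoot_of_isCanonicalSystem h1' h').unique_pos (isCharRoot_of_isCanonicalSystem h1 h)
    (by linarith) (by linarith)

/-! ## Integer sequences satisfying the recurrence -/

/-- The sequence `R` satisfies the recurrence of `exampleSeq`. -/
def LinRec (R : ℕ → ℤ) : Prop := ∀ n, R (n + 4) = 3 * R (n + 3) + 2 * R (n + 2) + 3 * R n

namespace LinRec

theorem exampleSeq_add (a : ℕ) : LinRec fun m => (exampleSeq (m + a) : ℤ) := by
  intro n
  have e : exampleSeq (n + 4 + a) = 3 * exampleSeq (n + 3 + a) + 2 * exampleSeq (n + 2 + a) +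
      3 * exampleSeq (n + a) := by
    rw [show n + 4 + a = n + a + 4 by ring, show n + 3 + a = n + a + 3 by ring,
      show n + 2 + a = n + a + 2 by ring]
    rfl
  simp only [e]
  push_cast
  ring

theorem sub {R T : ℕ → ℤ} (hR : LinRec R) (hT : LinRec T) : LinRec fun m => R m - T m := by
  intro n
  simp only [hR n, hT n]
  ring

theorem add {R T : ℕ → ℤ} (hR : LinRec R) (hT : LinRec T) : LinRec fun m => R m + T m := by
  intro n
  simp only [hR n, hT n]
  ring

theorem const_mul {R : ℕ → ℤ} (hR : LinRec R) (c : ℤ) : LinRec fun m => c * R m := by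
  intro n
  simp only [hR n]
  ring

theorem shift {R : ℕ → ℤ} (hR : LinRec R) (k : ℕ) : LinRec fun m => R (m + k) := by
  intro n
  have h := hR (n + k)
  simp only
  rw [show n + 4 + k = n + k + 4 by ring, show n + 3 + k = n + k + 3 by ring,
      show n + 2 + k = n + k + 2 by ring]
  exact h

/-- As the recurrence has nonnegative coefficients, lower bounds by `c ≥ 0` for four consecutive
terms propagate. -/
theorem le_of_window {R : ℕ → ℤ} (hR : LinRec R) {c : ℤ} (hc : 0 ≤ c) {M : ℕ}
    (h : ∀ i < 4, c ≤ R (M + i)) {m : ℕ} (hm : M ≤ m) : c ≤ R m := by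
  obtain ⟨k, rfl⟩ := Nat.exists_eq_add_of_le hm
  clear hm
  induction k using Nat.strong_induction_on with
  | _ k ih =>
    rcases Nat.lt_or_ge k 4 with hk | hk
    · exact h k hk
    · obtain ⟨j, rfl⟩ := Nat.exists_eq_add_of_le' hk
      have h0 := ih j (by omega)
      have h2 := ih (j + 2) (by omega)
      have h3 := ih (j + 3) (by omega)
      have e := hR (M + j)
      simp only [Nat.add_assoc] at e h0 h2 h3 ⊢
      omega

end LinRec

/-- Up to a constant, the coefficient of `x ^ n` in a sequence satisfying the recurrence, for a root
`x` of the characteristic polynomial. -/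
noncomputable def rootPart (x : ℝ) (R : ℕ → ℤ) : ℝ :=
  -- The coefficients are those of the quotient of the characteristic polynomial by `X - x`; applied
  -- to the shift operator, this quotient annihilates the components at the other roots.
  R 3 + (x - 3) * R 2 + (x ^ 2 - 3 * x - 2) * R 1 + (x ^ 3 - 3 * x ^ 2 - 2 * x) * R 0

theorem rootPart_succ {x : ℝ} (hx : IsCharRoot x) {R : ℕ → ℤ} (hR : LinRec R) :
    rootPart x (fun m => R (m + 1)) = x * rootPart x R := by
  have h := hR 0
  simp only [zero_add] at h
  simp only [rootPart, zero_add, Nat.reduceAdd, h]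
  push_cast
  unfold IsCharRoot at hx
  linear_combination (-(R 0 : ℝ)) * hx

theorem rootPart_add {x : ℝ} (hx : IsCharRoot x) {R : ℕ → ℤ} (hR : LinRec R) (k : ℕ) :
    rootPart x (fun m => R (m + k)) = x ^ k * rootPart x R := by
  induction k with
  | zero => simp
  | succ k ih =>
    have h := rootPart_succ hx (hR.shift k)
    rw [ih] at h
    rw [pow_succ', mul_assoc, ← h]
    congr 1
    funext m
    congr 1
    ring

theorem rootPart_exampleSeq (x : ℝ) :
    rootPart x (fun m => (exampleSeq m : ℤ)) = (1 + x) * (1 + x ^ 2) := by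
  simp only [rootPart, exampleSeq]
  push_cast
  ring

/-- Expanded in powers of `x`, the component has integer coefficients, all zero by linear
independence; this forces the first four terms to vanish. -/
theorem LinRec.eq_zero_of_rootPart_eq_zero {x : ℝ} (hx : IsCharRoot x) {R : ℕ → ℤ} (hR : LinRec R)
    (h : rootPart x R = 0) (m : ℕ) : R m = 0 := by
  have key := hx.coeff_eq_zero (a := R 3 - 3 * R 2 - 2 * R 1) (b := R 2 - 3 * R 1 - 2 * R 0)
    (c := R 1 - 3 * R 0) (d := R 0) (by
      rw [← h, rootPart]
      push_cast
      ring)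
  obtain ⟨h1, h2, h3, h4⟩ := key
  norm_cast at h1 h2 h3 h4
  induction m using Nat.strong_induction_on with
  | _ m ih =>
    match m, ih with
    | 0, _ => exact h4
    | 1, _ => omega
    | 2, _ => omega
    | 3, _ => omega
    | m + 4, ih =>
      rw [hR, ih m (by omega), ih (m + 2) (by omega), ih (m + 3) (by omega)]
      norm_num

theorem rootPart_eq_of_eventually_eq {x : ℝ} (hx : IsCharRoot x) (hx0 : x ≠ 0) {R T : ℕ → ℤ}
    (hR : LinRec R) (hT : LinRec T) (h : ∀ᶠ m in Filter.atTop, R m = T m) :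
    rootPart x R = rootPart x T := by
  obtain ⟨M, hM⟩ := Filter.eventually_atTop.mp h
  have h1 := rootPart_add hx hR M
  have h2 := rootPart_add hx hT M
  have h3 : (fun m => R (m + M)) = fun m => T (m + M) := funext fun m => hM _ (by omega)
  rw [h3, h2] at h1
  exact (mul_left_cancel₀ (pow_ne_zero _ hx0) h1).symm

/-- A sequence satisfying the recurrence differs from its part at the dominant root by
`O(2 ^ m)`. -/
theorem LinRec.exists_abs_sub_le {β : ℝ} (hβ : IsCharRoot β) (h1 : 3.616445 < β)
    (h2 : β < 3.616455) {R : ℕ → ℤ} (hR : LinRec R) : ∃ K D : ℝ, (rootPart β R = 0 ∨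
      0 < K * rootPart β R) ∧ ∀ m, |(R m : ℝ) - K * β ^ m| ≤ D * 2 ^ m := by
  set C := rootPart β R with hC
  set a := β - 3 with ha
  set b := β ^ 2 - 3 * β - 2 with hb
  set c := β ^ 3 - 3 * β ^ 2 - 2 * β with hc
  have ha0 : 0 < a ∧ a < 0.7 := by constructor <;> linarith
  have hb0 : 0 < b ∧ b < 0.3 := by constructor <;> nlinarith
  have hcb : c = β * b := by rw [hc, hb]; ring
  have hc0 : 0 < c ∧ c < 1.2 := by
    rw [hcb]
    constructor <;> nlinarith [hb0.1, hb0.2]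
  -- The quotient of the characteristic polynomial by `X - β` turns `R` into a geometric sequence,
  -- so `R` satisfies an inhomogeneous recurrence of order three.
  have hrec : ∀ m, (R (m + 3) : ℝ) + a * R (m + 2) + b * R (m + 1) + c * R m = C * β ^ m := by
    intro m
    have h := rootPart_add hβ hR m
    rw [mul_comm C, hC, ← h, rootPart, hb, ha, hc]
    simp only [zero_add, add_comm m]
  -- `Q` is the value of this quotient at `β`, so that `K * β ^ m` is a particular solution.
  set Q := β ^ 3 + a * β ^ 2 + b * β + c with hQ
  have hβ0 : 0 < β := by linarith
  have hQ0 : 0 < Q := by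
    have := ha0.1
    have := hb0.1
    have := hc0.1
    positivity
  set K := C / Q with hK
  have hKQ : K * Q = C := by rw [hK]; field_simp
  obtain ⟨T, hT⟩ : ∃ T : ℕ → ℝ, ∀ m, T m = R m - K * β ^ m := ⟨_, fun _ => rfl⟩
  have hTrec : ∀ m, T (m + 3) = -(a * T (m + 2) + b * T (m + 1) + c * T m) := by
    intro m
    rw [hT, hT, hT, hT]
    linear_combination hrec m - β ^ m * hKQ
  set D := max |T 0| (max |T 1| |T 2|) with hD
  have hD0 : 0 ≤ D := (abs_nonneg _).trans (le_max_left _ _)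
  refine ⟨K, D, ?_, ?_⟩
  · by_cases hC0 : C = 0
    · exact Or.inl hC0
    · right
      rw [hK, div_mul_eq_mul_div]
      exact div_pos (mul_self_pos.mpr hC0) hQ0
  · intro m
    rw [← hT]
    induction m using Nat.strong_induction_on with
    | _ m ih =>
      match m, ih with
      | 0, _ =>
        have : |T 0| ≤ D := le_max_left _ _
        simpa using this
      | 1, _ =>
        have : |T 1| ≤ D := (le_max_left _ _).trans (le_max_right _ _)
        linarith
      | 2, _ =>
        have : |T 2| ≤ D := (le_max_right _ _).trans (le_max_right _ _)
        linarith
      | m + 3, ih =>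
        have t0 := ih m (by omega)
        have t1 := ih (m + 1) (by omega)
        have t2 := ih (m + 2) (by omega)
        have hE : 0 ≤ D * 2 ^ m := by positivity
        rw [pow_succ, ← mul_assoc] at t1
        rw [pow_add, ← mul_assoc] at t2 ⊢
        generalize D * 2 ^ m = E at *
        rw [hTrec, abs_neg]
        have s0 : |c * T m| ≤ 1.2 * E := by
          rw [abs_mul, abs_of_pos hc0.1]
          exact mul_le_mul hc0.2.le t0 (abs_nonneg _) (by norm_num)
        have s1 : |b * T (m + 1)| ≤ 0.3 * (E * 2) := by
          rw [abs_mul, abs_of_pos hb0.1]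
          exact mul_le_mul hb0.2.le t1 (abs_nonneg _) (by norm_num)
        have s2 : |a * T (m + 2)| ≤ 0.7 * (E * 2 ^ 2) := by
          rw [abs_mul, abs_of_pos ha0.1]
          exact mul_le_mul ha0.2.le t2 (abs_nonneg _) (by norm_num)
        have := abs_add_le (a * T (m + 2) + b * T (m + 1)) (c * T m)
        have := abs_add_le (a * T (m + 2)) (b * T (m + 1))
        -- The total is at most `(1.2 + 0.3 * 2 + 0.7 * 4) * E = 4.6 * E`, below `E * 2 ^ 3`.
        linarith

/-- An integer sequence satisfying the recurrence has eventually constant sign. -/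
theorem LinRec.eventually_nonneg_or_neg {R : ℕ → ℤ} (hR : LinRec R) :
    (∀ᶠ m in Filter.atTop, 0 ≤ R m) ∨ ∀ᶠ m in Filter.atTop, R m < 0 := by
  obtain ⟨β, hβ, h1, h2⟩ := exists_dominant_root
  obtain ⟨K, D, hK, hD⟩ := hR.exists_abs_sub_le hβ h1 h2
  rcases eq_or_ne (rootPart β R) 0 with h0 | h0
  · exact Or.inl (Filter.Eventually.of_forall fun m =>
      (hR.eq_zero_of_rootPart_eq_zero hβ h0 m).ge)
  have hK0 : K ≠ 0 := by
    rintro rfl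
    rcases hK with h | h
    · exact h0 h
    · simp at h
  have hlim : ∀ᶠ m : ℕ in Filter.atTop, D * 2 ^ m < |K| * β ^ m := by
    have h3 : Filter.Tendsto (fun m : ℕ => (β / 2) ^ m) Filter.atTop Filter.atTop :=
      tendsto_pow_atTop_atTop_of_one_lt (by linarith)
    filter_upwards [h3.eventually_gt_atTop (D / |K|)] with m hm
    rw [div_lt_iff₀ (abs_pos.mpr hK0), div_pow, div_mul_eq_mul_div,
      lt_div_iff₀ (by positivity)] at hm
    linarith
  rcases lt_or_gt_of_ne hK0 with h | h
  · right
    filter_upwards [hlim] with m hm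
    rw [abs_of_neg h] at hm
    have := (abs_le.mp (hD m)).2
    have h4 : (R m : ℝ) < 0 := by linarith
    exact_mod_cast h4
  · left
    filter_upwards [hlim] with m hm
    rw [abs_of_pos h] at hm
    have := (abs_le.mp (hD m)).1
    have h4 : (0 : ℝ) ≤ R m := by linarith
    exact_mod_cast h4

/-- A bounded sequence of natural numbers all of whose level sets `{m | e ≤ f m}` are eventually
decided is eventually constant. -/
theorem eventually_const_of_levels {f : ℕ → ℕ} {B : ℕ} (hB : ∀ᶠ m in Filter.atTop, f m ≤ B)
    (h : ∀ e, 1 ≤ e → (∀ᶠ m in Filter.atTop, e ≤ f m) ∨ ∀ᶠ m in Filter.atTop, f m < e) :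
    ∃ d, ∀ᶠ m in Filter.atTop, f m = d := by
  classical
  have hex : ∃ e, ∀ᶠ m in Filter.atTop, f m < e + 1 :=
    ⟨B, hB.mono fun m hm => by omega⟩
  refine ⟨Nat.find hex, ?_⟩
  have h1 := Nat.find_spec hex
  rcases Nat.eq_zero_or_pos (Nat.find hex) with h0 | h0
  · filter_upwards [h1] with m hm
    omega
  · rcases h (Nat.find hex) h0 with h2 | h2
    · filter_upwards [h1, h2] with m hm hm'
      omega
    · exfalso
      refine Nat.find_min hex (m := Nat.find hex - 1) (by omega) ?_
      rwa [Nat.sub_add_cancel h0]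

/-! ## Greedy words over the natural numbers -/

/-- The value of the word `w` followed by `m` zeros. -/
def wordVal : List ℕ → ℕ → ℕ
  | [], _ => 0
  | d :: w, m => d * exampleSeq (w.length + m) + wordVal w m

/-- All suffixes satisfy the greedy condition. -/
def Admissible : List ℕ → Prop
  | [] => True
  | d :: w => wordVal (d :: w) 0 < exampleSeq (w.length + 1) ∧ Admissible w

/-- `w` is the greedy representation of `n`, as a word of natural numbers. -/
structure IsGreedyWord (n : ℕ) (w : List ℕ) : Prop where
  val_eq : wordVal w 0 = n
  head_ne : ∀ d ∈ w.head?, d ≠ 0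
  admissible : Admissible w

theorem wordVal_append (u z : List ℕ) (m : ℕ) :
    wordVal (u ++ z) m = wordVal u (z.length + m) + wordVal z m := by
  induction u with
  | nil => simp [wordVal]
  | cons d u ih =>
    simp only [List.cons_append, wordVal, ih, List.length_append]
    ring_nf

theorem Admissible.of_append {u z : List ℕ} (h : Admissible (u ++ z)) : Admissible z := by
  induction u with
  | nil => exact h
  | cons d u ih => exact ih h.2

theorem Admissible.wordVal_lt {w : List ℕ} (h : Admissible w) :
    wordVal w 0 < exampleSeq w.length := by
  cases w with
  | nil => simp [wordVal, exampleSeq]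
  | cons d w => exact h.1

theorem admissible_append {u z : List ℕ} (hz : Admissible z)
    (h : ∀ v, v <:+ u → wordVal v z.length + wordVal z 0 < exampleSeq (v.length + z.length)) :
    Admissible (u ++ z) := by
  induction u with
  | nil => exact hz
  | cons d u ih =>
    refine ⟨?_, ih fun v hv => h v (hv.trans (List.suffix_cons d u))⟩
    have h1 := h (d :: u) List.suffix_rfl
    change wordVal ((d :: u) ++ z) 0 < exampleSeq ((u ++ z).length + 1)
    rw [ wordVal_append, add_zero]
    convert h1 using 2
    simp only [List.length_append, List.length_cons]
    ring

/-- The greedy conditions are upper bounds, so a tail may be replaced by an admissible one of equal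
length and no larger value. This permits the exchange of tails between prefixes. -/
theorem Admissible.mono {u z z' : List ℕ} (h : Admissible (u ++ z')) (hz : Admissible z)
    (hl : z.length = z'.length) (hv : wordVal z 0 ≤ wordVal z' 0) : Admissible (u ++ z) := by
  induction u with
  | nil => exact hz
  | cons d u ih =>
    refine ⟨?_, ih h.2⟩
    have h1 : wordVal ((d :: u) ++ z') 0 < exampleSeq ((u ++ z').length + 1) := h.1
    change wordVal ((d :: u) ++ z) 0 < exampleSeq ((u ++ z).length + 1)
    rw [wordVal_append] at h1 ⊢
    rw [List.length_append] at h1 ⊢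
    rw [hl]
    omega

theorem exampleSeq_strictMono : StrictMono exampleSeq := exampleSystem.strictMono_seq

theorem exampleSeq_pos (n : ℕ) : 0 < exampleSeq n := exampleSystem.seq_pos n

theorem wordVal_map (w : List exampleSystem.Digit) :
    wordVal (w.map Fin.val) 0 = exampleSystem.val w := by
  induction w with
  | nil => rfl
  | cons d w ih =>
    simp only [List.map_cons, wordVal, ih, NumerationSystem.val, List.length_map, add_zero]
    rfl

theorem admissible_map {w : List exampleSystem.Digit} :
    Admissible (w.map Fin.val) ↔
      ∀ v : List exampleSystem.Digit, v <:+ w → exampleSystem.val v < exampleSystem.seq v.length := by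
  induction w with
  | nil =>
    simp only [List.map_nil, Admissible, true_iff]
    intro v hv
    rw [List.suffix_nil.mp hv]
    exact exampleSeq_pos 0
  | cons d w ih =>
    simp only [List.map_cons, Admissible, List.suffix_cons_iff]
    rw [← List.map_cons (f := Fin.val), wordVal_map, ih,
      List.length_map]
    constructor
    · rintro ⟨h1, h2⟩ v (rfl | hv)
      · exact h1
      · exact h2 v hv
    · exact fun h => ⟨h _ (Or.inl rfl), fun v hv => h v (Or.inr hv)⟩

theorem isGreedyWord_map {n : ℕ} {w : List exampleSystem.Digit} :
    IsGreedyWord n (w.map Fin.val) ↔ exampleSystem.IsGreedyRep n w := by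
  constructor
  · rintro ⟨h1, h2, h3⟩
    refine ⟨by rw [← wordVal_map, h1], fun d hd => h2 d ?_, admissible_map.mp h3⟩
    rw [List.head?_map]
    exact Option.mem_map_of_mem _ hd
  · rintro ⟨h1, h2, h3⟩
    refine ⟨by rw [wordVal_map, h1], fun d hd => ?_, admissible_map.mpr h3⟩
    rw [List.head?_map] at hd
    obtain ⟨e, he, rfl⟩ := Option.mem_map.mp hd
    exact h2 e he

theorem exists_isGreedyWord (n : ℕ) : ∃ w, IsGreedyWord n w :=
  ⟨_, isGreedyWord_map.mpr (exampleSystem.isGreedyRep_rep n)⟩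

theorem Admissible.digit_lt {w : List ℕ} (h : Admissible w) : ∀ d ∈ w, d < exampleSystem.bound := by
  induction w with
  | nil => simp
  | cons e w ih =>
    intro d hd
    rcases List.mem_cons.mp hd with rfl | hd
    · have h1 := h.1
      have h2 : exampleSeq (w.length + 1) ≤ exampleSystem.bound * exampleSeq w.length :=
        exampleSystem.seq_succ_le w.length
      simp only [wordVal, add_zero] at h1
      exact lt_of_mul_lt_mul_right (by omega : d * exampleSeq w.length <
        exampleSystem.bound * exampleSeq w.length) (Nat.zero_le _)
    · exact ih h.2 d hd

theorem IsGreedyWord.eq_map_rep {n : ℕ} {w : List ℕ} (h : IsGreedyWord n w) :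
    w = (exampleSystem.rep n).map Fin.val := by
  have hd := h.admissible.digit_lt
  obtain ⟨v, rfl⟩ : ∃ v : List exampleSystem.Digit, v.map Fin.val = w := by
    clear h
    induction w with
    | nil => exact ⟨[], rfl⟩
    | cons d w ih =>
      obtain ⟨v, hv⟩ := ih fun e he => hd e (List.mem_cons_of_mem _ he)
      exact ⟨⟨d, hd d List.mem_cons_self⟩ :: v, by rw [List.map_cons, hv]⟩
  rw [(exampleSystem.existsUnique_isGreedyRep n).unique (isGreedyWord_map.mp h)
    (exampleSystem.isGreedyRep_rep n)]

theorem exists_admissible {r m : ℕ} (h : r < exampleSeq m) :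
    ∃ z, z.length = m ∧ wordVal z 0 = r ∧ Admissible z := by
  obtain ⟨w, h1, h2, h3⟩ := exampleSystem.exists_padded m r h
  exact ⟨w.map Fin.val, by simpa using h1, by rw [wordVal_map, h2], admissible_map.mpr h3⟩

theorem Admissible.head_le {d : ℕ} {w : List ℕ} (h : Admissible (d :: w)) : d ≤ 3 := by
  have h1 := h.1
  simp only [wordVal, add_zero] at h1
  have h2 := (exampleSeq_growth w.length).2
  have h3 := exampleSeq_pos w.length
  by_contra h4
  have : 4 * exampleSeq w.length ≤ d * exampleSeq w.length := Nat.mul_le_mul_right _ (by omega)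
  omega

theorem pow_mul_exampleSeq_le (m k : ℕ) : 3 ^ k * exampleSeq m ≤ exampleSeq (m + k) := by
  induction k with
  | zero => simp
  | succ k ih =>
    have h := (exampleSeq_growth (m + k)).1
    rw [pow_succ, ← add_assoc]
    linarith

/-! ## Prefixes of the representations of `t * U n` -/

/-- For all large `m`, the word `u` is the prefix of the representation of `t * U (m + a)` with
`m + b` digits missing. -/
def IsStablePrefix (t : ℕ) (u : List ℕ) (a b : ℕ) : Prop :=
  ∀ᶠ m in Filter.atTop, ∃ z : List ℕ, z.length = m + b ∧
    IsGreedyWord (t * exampleSeq (m + a)) (u ++ z)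

theorem linRec_wordVal (u : List ℕ) : LinRec fun m => (wordVal u m : ℤ) := by
  induction u with
  | nil => intro n; simp [wordVal]
  | cons d u ih =>
    have h := ((LinRec.exampleSeq_add u.length).const_mul d).add ih
    convert h using 2 with m
    simp only [wordVal, add_comm]
    push_cast
    ring

/-- Replacing `m` by `m + 1` frees one unread digit, which `IsStablePrefix.extend` can then fix. -/
theorem IsStablePrefix.reindex {t : ℕ} {u : List ℕ} {a : ℕ} (h : IsStablePrefix t u a 0) :
    IsStablePrefix t u (a + 1) 1 := by
  have h1 := (Filter.tendsto_add_atTop_nat 1).eventually h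
  filter_upwards [h1] with m ⟨z, hz, hg⟩
  exact ⟨z, hz, by rwa [show m + (a + 1) = m + 1 + a by ring]⟩

/-- The next digit is at least `e` exactly when `t U (m+a) - wordVal u (m+b+1) - e U (m+b)` is
nonnegative. This expression satisfies the recurrence in `m`, so every such comparison is eventually
decided, and the digit, being at most 3, is eventually constant. -/
theorem IsStablePrefix.extend {t : ℕ} {u : List ℕ} {a b : ℕ} (h : IsStablePrefix t u a (b + 1)) :
    ∃ d ≤ 3, IsStablePrefix t (u ++ [d]) a b := by
  have h1 : ∀ m, ∃ d, (∃ z : List ℕ, z.length = m + (b + 1) ∧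
      IsGreedyWord (t * exampleSeq (m + a)) (u ++ z)) → ∃ z : List ℕ, z.length = m + b ∧
      IsGreedyWord (t * exampleSeq (m + a)) (u ++ d :: z) := by
    intro m
    by_cases hm : ∃ z : List ℕ, z.length = m + (b + 1) ∧
      IsGreedyWord (t * exampleSeq (m + a)) (u ++ z)
    · obtain ⟨z, hz, hg⟩ := hm
      cases z with
      | nil => simp at hz
      | cons d z => exact ⟨d, fun _ => ⟨z, by simp at hz; omega, hg⟩⟩
    · exact ⟨0, fun h => absurd h hm⟩
  choose f hf using h1
  have h2 : ∀ᶠ m in Filter.atTop, f m ≤ 3 := by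
    filter_upwards [h] with m hm
    obtain ⟨z, -, hg⟩ := hf m hm
    exact hg.admissible.of_append.head_le
  obtain ⟨d, hd⟩ := eventually_const_of_levels h2 (by
    intro e _
    have hR : LinRec fun m => ((t : ℤ) * exampleSeq (m + a) - wordVal u (m + (b + 1))) -
        e * exampleSeq (m + b) :=
      (((LinRec.exampleSeq_add a).const_mul t).sub ((linRec_wordVal u).shift (b + 1))).sub
        ((LinRec.exampleSeq_add b).const_mul e)
    refine hR.eventually_nonneg_or_neg.imp (fun hs => ?_) (fun hs => ?_) <;>
    · filter_upwards [h, hs] with m hm hs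
      obtain ⟨z, hz, hg⟩ := hf m hm
      have hv := hg.val_eq
      have hlt := hg.admissible.of_append.2.wordVal_lt
      rw [wordVal_append] at hv
      simp only [wordVal, List.length_cons, add_zero, hz] at hv
      rw [hz] at hlt
      rw [add_assoc m b 1] at hv
      have hv' : ((t : ℤ) * exampleSeq (m + a)) = wordVal u (m + (b + 1)) +
          (f m * exampleSeq (m + b) + wordVal z 0) := by exact_mod_cast hv.symm
      rw [hv'] at hs
      zify at hlt ⊢
      by_contra hc
      push Not at hc
      have hp : (0 : ℤ) ≤ exampleSeq (m + b) := by positivity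
      nlinarith)
  obtain ⟨m, hm, hm3⟩ := (hd.and h2).exists
  refine ⟨d, by omega, ?_⟩
  filter_upwards [h, hd] with m hm hd
  obtain ⟨z, hz, hg⟩ := hf m hm
  exact ⟨z, hz, by rwa [List.append_assoc, List.singleton_append, ← hd]⟩

/-- The representation has more than `m + e` digits exactly when `U (m + e) ≤ t * U m`, which is
eventually decided. The bound on `3 ^ l` serves the estimate for large `t`. -/
theorem exists_isStablePrefix_nil {t : ℕ} (ht : 1 ≤ t) :
    ∃ l, 3 ^ l ≤ t ∧ IsStablePrefix t [] 0 (l + 1) := by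
  choose w hw using fun m => exists_isGreedyWord (t * exampleSeq m)
  have h1 : ∀ m, ∃ l, (w m).length = m + l + 1 := by
    intro m
    have h2 := (hw m).admissible.wordVal_lt
    rw [(hw m).val_eq] at h2
    have h3 := exampleSeq_strictMono.lt_iff_lt.mp
      ((Nat.le_mul_of_pos_left (exampleSeq m) ht).trans_lt h2)
    exact ⟨(w m).length - m - 1, by omega⟩
  choose f hf using h1
  have h2 : ∀ m, exampleSeq (m + f m) ≤ t * exampleSeq m ∧
      t * exampleSeq m < exampleSeq (m + f m + 1) := by
    intro m
    have h3 := (hw m).admissible.wordVal_lt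
    have h4 := (hw m).val_eq
    have h5 := (hw m).head_ne
    have h6 := hf m
    cases hwm : w m with
    | nil => rw [hwm] at h6; simp at h6
    | cons d z =>
      rw [hwm] at h3 h4 h5 h6
      have h7 := Nat.pos_of_ne_zero (h5 d (by simp))
      rw [h4, h6] at h3
      refine ⟨?_, h3⟩
      rw [← h4]
      have h8 : z.length = m + f m := by simpa using h6
      simp only [wordVal, h8, add_zero]
      exact (Nat.le_mul_of_pos_left _ h7).trans (Nat.le_add_right _ _)
  have h3 : ∀ m, 3 ^ f m ≤ t := fun m =>
    Nat.le_of_mul_le_mul_right ((pow_mul_exampleSeq_le m (f m)).trans (h2 m).1) (exampleSeq_pos m)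
  obtain ⟨l, hl⟩ := eventually_const_of_levels (f := f) (B := t)
    (Filter.Eventually.of_forall fun m => (Nat.lt_pow_self (by norm_num)).le.trans (h3 m)) (by
    intro e _
    have hR : LinRec fun m => (t : ℤ) * exampleSeq (m + 0) - exampleSeq (m + e) :=
      ((LinRec.exampleSeq_add 0).const_mul t).sub (LinRec.exampleSeq_add e)
    refine hR.eventually_nonneg_or_neg.imp (fun hs => ?_) (fun hs => ?_)
    · filter_upwards [hs] with m hs
      have h4 : exampleSeq (m + e) ≤ t * exampleSeq m := by
        rw [add_zero] at hs
        zify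
        linarith
      have := exampleSeq_strictMono.lt_iff_lt.mp (h4.trans_lt (h2 m).2)
      omega
    · filter_upwards [hs] with m hs
      have h4 : t * exampleSeq m < exampleSeq (m + e) := by
        rw [add_zero] at hs
        zify
        linarith
      have := exampleSeq_strictMono.lt_iff_lt.mp ((h2 m).1.trans_lt h4)
      omega)
  obtain ⟨m, hm⟩ := hl.exists
  refine ⟨l, hm ▸ h3 m, ?_⟩
  filter_upwards [hl] with m hm
  exact ⟨w m, by rw [hf m, hm]; ring, hw m⟩

/-- A criterion for stable prefixes which looks at four consecutive indices only. -/
theorem isStablePrefix_of_window {t d : ℕ} {w : List ℕ} {a : ℕ} (hd : d ≠ 0) (M : ℕ)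
    (h1 : ∀ i < 4, wordVal (d :: w) (M + i) ≤ t * exampleSeq (M + i + a))
    (h2 : ∀ v ∈ (d :: w).tails, ∀ i < 4, t * exampleSeq (M + i + a) + wordVal v (M + i) <
      exampleSeq (M + i + v.length) + wordVal (d :: w) (M + i)) :
    IsStablePrefix t (d :: w) a 0 := by
  generalize hu : d :: w = u at h1 h2 ⊢
  have hR : LinRec fun m => (t : ℤ) * exampleSeq (m + a) - wordVal u m :=
    ((LinRec.exampleSeq_add a).const_mul t).sub (linRec_wordVal u)
  have k1 : ∀ m, M ≤ m → wordVal u m ≤ t * exampleSeq (m + a) := by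
    intro m hm
    have h3 := hR.le_of_window le_rfl (M := M) (fun i hi => by
      have := h1 i hi
      zify at this
      linarith) hm
    zify
    linarith
  have k2 : ∀ m, M ≤ m → ∀ v, v <:+ u → t * exampleSeq (m + a) + wordVal v m <
      exampleSeq (m + v.length) + wordVal u m := by
    intro m hm v hv
    have h3 := (((LinRec.exampleSeq_add v.length).sub (linRec_wordVal v)).sub hR).le_of_window
      -- A strict inequality between integers is a lower bound by 1, the form that propagates along
      -- the recurrence.
      (c := 1) (by norm_num) (M := M) (fun i hi => by
        have := h2 v ((List.mem_tails _ _).mpr hv) i hi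
        zify at this
        linarith) hm
    zify
    linarith
  filter_upwards [Filter.eventually_ge_atTop M] with m hm
  have e1 := k1 m hm
  -- The empty suffix bounds the remainder by `U m`, so that it fits into `m` digits.
  have e2 := k2 m hm [] List.nil_suffix
  simp only [wordVal, List.length_nil, add_zero] at e2
  obtain ⟨z, hz1, hz2, hz3⟩ := exists_admissible (r := t * exampleSeq (m + a) - wordVal u m)
    (m := m) (by omega)
  refine ⟨z, hz1, ?_, ?_, admissible_append hz3 ?_⟩
  · rw [wordVal_append, hz1, hz2, add_zero]
    omega
  · intro e he
    rw [← hu] at he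
    obtain rfl : d = e := by simpa using he
    exact hd
  · intro v hv
    have := k2 m hm v hv
    rw [hz1, hz2, add_comm v.length]
    omega

/-! ## The conjugate of modulus greater than one -/

/-- The value of the word `u` in base `x`. -/
noncomputable def baseVal (x : ℝ) : List ℕ → ℝ
  | [] => 0
  | d :: u => d * x ^ u.length + baseVal x u

theorem baseVal_concat (x : ℝ) (u : List ℕ) (d : ℕ) :
    baseVal x (u ++ [d]) = x * baseVal x u + d := by
  induction u with
  | nil => simp [baseVal]
  | cons e u ih =>
    simp only [List.cons_append, baseVal, ih, List.length_append, List.length_singleton]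
    ring

/-- The error of the prefix `u` in the expansion of `t` in base `x`, scaled by `x ^ a`. -/
noncomputable def defect (x : ℝ) (t : ℕ) (u : List ℕ) (a : ℕ) : ℝ := t * x ^ a - baseVal x u

theorem defect_concat (x : ℝ) (t : ℕ) (u : List ℕ) (a d : ℕ) :
    defect x t (u ++ [d]) (a + 1) = x * defect x t u a - d := by
  rw [defect, defect, baseVal_concat]
  ring

theorem rootPart_wordVal {x : ℝ} (hx : IsCharRoot x) (u : List ℕ) :
    rootPart x (fun m => (wordVal u m : ℤ)) = (1 + x) * (1 + x ^ 2) * baseVal x u := by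
  induction u with
  | nil => simp [rootPart, wordVal, baseVal]
  | cons d u ih =>
    have h := rootPart_add hx (LinRec.exampleSeq_add 0) u.length
    simp only [add_zero] at h
    rw [rootPart_exampleSeq] at h
    rw [baseVal, mul_add, ← ih, mul_left_comm, mul_comm _ (x ^ u.length), ← h]
    simp only [rootPart, wordVal, add_comm u.length]
    push_cast
    ring

/-- This identifies the defect as the component of the remainder at `x`; the factor `1 + x + x ^ 2 +
x ^ 3` is the component of `U` itself. -/
theorem rootPart_residual {x : ℝ} (hx : IsCharRoot x) (t : ℕ) (u : List ℕ) (a : ℕ) :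
    rootPart x (fun m => (t : ℤ) * exampleSeq (m + a) - wordVal u m) =
      (1 + x) * (1 + x ^ 2) * defect x t u a := by
  have h := rootPart_add hx (LinRec.exampleSeq_add 0) a
  simp only [add_zero] at h
  rw [rootPart_exampleSeq] at h
  rw [defect, mul_sub, ← rootPart_wordVal hx, mul_left_comm, mul_comm _ (x ^ a), ← h]
  simp only [rootPart]
  push_cast
  ring

/-! ## States of an automaton determine the defect -/

section Automaton

variable {Q : Type*} {start : Q} {step : Q → ℕ → Q} {acc : Q → Prop} {t : ℕ}

/-- The word `u' ++ z` is greedy and accepted, so its value is some `t U k`, at most `t U (m+a')`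
and less than `U m` below it. As `t ≥ 2`, the gap `t (U (n+1) - U n)` exceeds `U (n+1)`, which is at
least `U m` for `n + 1 = m + a'`. Hence `k = m + a'`. -/
theorem wordVal_eq_of_foldl_eq_of_le (ht : 2 ≤ t)
    (hacc : ∀ n w, IsGreedyWord n w → (acc (w.foldl step start) ↔ ∃ k, n = t * exampleSeq k))
    {u u' z z' : List ℕ} {a a' m : ℕ} (hu' : u' ≠ [])
    (hst : u.foldl step start = u'.foldl step start) (hz : z.length = m) (hz' : z'.length = m)
    (hg : IsGreedyWord (t * exampleSeq (m + a)) (u ++ z))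
    (hg' : IsGreedyWord (t * exampleSeq (m + a')) (u' ++ z'))
    (hle : wordVal z 0 ≤ wordVal z' 0) : wordVal z 0 = wordVal z' 0 := by
  have h1 : IsGreedyWord (wordVal (u' ++ z) 0) (u' ++ z) := by
    refine ⟨rfl, ?_, hg'.admissible.mono hg.admissible.of_append (hz.trans hz'.symm) hle⟩
    -- The leading digit lies in the nonempty prefix, so exchanging tails keeps it nonzero.
    have h2 := hg'.head_ne
    cases u' with
    | nil => exact absurd rfl hu'
    | cons e u' => exact h2
  have h2 : acc ((u' ++ z).foldl step start) := by
    rw [List.foldl_append, ← hst, ← List.foldl_append]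
    exact (hacc _ _ hg).mpr ⟨_, rfl⟩
  obtain ⟨k, hk⟩ := (hacc _ _ h1).mp h2
  have h3 := hg'.val_eq
  have h4 := hg'.admissible.of_append.wordVal_lt
  rw [wordVal_append, hz, add_zero] at hk
  rw [wordVal_append, hz', add_zero] at h3
  rw [hz'] at h4
  have h5 : exampleSeq m ≤ exampleSeq (m + a') := exampleSeq_strictMono.monotone (by omega)
  rcases lt_trichotomy k (m + a') with h | h | h
  · exfalso
    obtain ⟨n, hn⟩ : ∃ n, m + a' = n + 1 := ⟨m + a' - 1, by omega⟩
    have h6 : exampleSeq k ≤ exampleSeq n := exampleSeq_strictMono.monotone (by omega)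
    have h7 := (exampleSeq_growth n).1
    rw [hn] at h3 h5
    obtain ⟨c, rfl⟩ := Nat.exists_eq_add_of_le ht
    have h8 : (2 + c) * exampleSeq k ≤ (2 + c) * exampleSeq n := Nat.mul_le_mul_left _ h6
    have h9 : c * exampleSeq n ≤ c * exampleSeq (n + 1) := Nat.mul_le_mul_left _ (by omega)
    rw [add_mul] at h3
    rw [add_mul 2 c (exampleSeq n)] at h8
    omega
  · rw [h] at hk
    omega
  · exfalso
    have h6 : t * exampleSeq (m + a') < t * exampleSeq k :=
      Nat.mul_lt_mul_of_pos_left (exampleSeq_strictMono h) (by omega)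
    omega

/-- The remainders agree for all large `m` and satisfy the recurrence, so their components at `x`
agree; the factor `(1 + x) * (1 + x ^ 2)` cancels since `x ≠ -1`. -/
theorem defect_eq_of_foldl_eq (ht : 2 ≤ t)
    (hacc : ∀ n w, IsGreedyWord n w → (acc (w.foldl step start) ↔ ∃ k, n = t * exampleSeq k))
    {x : ℝ} (hx : IsCharRoot x) (hx0 : x ≠ 0) (hx1 : x ≠ -1) {u u' : List ℕ} {a a' : ℕ}
    (hu : u ≠ []) (hu' : u' ≠ []) (h : IsStablePrefix t u a 0) (h' : IsStablePrefix t u' a' 0)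
    (hst : u.foldl step start = u'.foldl step start) : defect x t u a = defect x t u' a' := by
  have hR : ∀ (u : List ℕ) (a : ℕ), LinRec fun m => (t : ℤ) * exampleSeq (m + a) - wordVal u m :=
    fun u a => ((LinRec.exampleSeq_add a).const_mul t).sub (linRec_wordVal u)
  have key := rootPart_eq_of_eventually_eq hx hx0 (hR u a) (hR u' a') (by
    filter_upwards [h, h'] with m ⟨z, hz, hg⟩ ⟨z', hz', hg'⟩
    have e : wordVal z 0 = wordVal z' 0 := by
      rcases le_total (wordVal z 0) (wordVal z' 0) with hle | hle
      · exact wordVal_eq_of_foldl_eq_of_le ht hacc hu' hst hz hz' hg hg' hle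
      · exact (wordVal_eq_of_foldl_eq_of_le ht hacc hu hst.symm hz' hz hg' hg hle).symm
    have h1 := hg.val_eq
    have h2 := hg'.val_eq
    rw [wordVal_append, hz, add_zero, add_zero] at h1
    rw [wordVal_append, hz', add_zero, add_zero] at h2
    zify at h1 h2 e
    linarith)
  rw [rootPart_residual hx, rootPart_residual hx] at key
  refine mul_left_cancel₀ (mul_ne_zero (fun h0 => hx1 (by linarith)) ?_) key
  positivity

/-- If the defects of the stable prefixes are unbounded, then no finite automaton recognizes the
representations of the numbers `t * U n`. -/
theorem not_finite_of_defect_unbounded [Finite Q] (ht : 2 ≤ t)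
    (hacc : ∀ n w, IsGreedyWord n w → (acc (w.foldl step start) ↔ ∃ k, n = t * exampleSeq k))
    {x : ℝ} (hx : IsCharRoot x) (hx0 : x ≠ 0) (hx1 : x ≠ -1)
    (hunb : ∀ K : ℝ, ∃ u a, u ≠ [] ∧ IsStablePrefix t u a 0 ∧ K < |defect x t u a|) : False := by
  have h1 : ∀ q : Q, ∃ y : ℝ, ∀ u a, u ≠ [] → IsStablePrefix t u a 0 → u.foldl step start = q →
      |defect x t u a| = y := by
    intro q
    by_cases hq : ∃ u a, u ≠ [] ∧ IsStablePrefix t u a 0 ∧ u.foldl step start = q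
    · obtain ⟨u, a, hu, h, hst⟩ := hq
      refine ⟨|defect x t u a|, fun u' a' hu' h' hst' => ?_⟩
      rw [defect_eq_of_foldl_eq ht hacc hx hx0 hx1 hu' hu h' h (hst'.trans hst.symm)]
    · exact ⟨0, fun u a hu h hst => absurd ⟨u, a, hu, h, hst⟩ hq⟩
  choose f hf using h1
  obtain ⟨K, hK⟩ := (Set.finite_range f).bddAbove
  obtain ⟨u, a, hu, h, hlt⟩ := hunb K
  have h2 := hf _ u a hu h rfl
  have h3 := hK (Set.mem_range_self (u.foldl step start))
  rw [← h2] at h3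
  linarith

end Automaton

/-! ## Divergence of the defect -/

/-- A digit `0 ≤ d ≤ 3` sends `y ≥ B + E` to `x * y - d ≤ x * B - |x| * E`, and `y ≤ x * B - E` to
`x * y - d ≥ x ^ 2 * B - 3 + |x| * E = B + |x| * E`. The defect changes sides while the bound on its
distance to `[x * B, B]` grows by the factor `|x|`. -/
theorem exists_defect_outside {t : ℕ} {x B E : ℝ} (hx : x < -1)
    (hB : B * (x ^ 2 - 1) = 3) {u : List ℕ} {a : ℕ} (hu : u ≠ []) (h : IsStablePrefix t u a 0)
    (hout : B + E ≤ defect x t u a ∨ defect x t u a ≤ x * B - E) (k : ℕ) :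
    ∃ u a, u ≠ [] ∧ IsStablePrefix t u a 0 ∧
      (B + (-x) ^ k * E ≤ defect x t u a ∨ defect x t u a ≤ x * B - (-x) ^ k * E) := by
  induction k with
  | zero => exact ⟨u, a, hu, h, by simpa using hout⟩
  | succ k ih =>
    obtain ⟨v, b, -, hv, ho⟩ := ih
    obtain ⟨d, hd, hvd⟩ := hv.reindex.extend
    have hd3 : (d : ℝ) ≤ 3 := by exact_mod_cast hd
    have hd0 : (0 : ℝ) ≤ d := Nat.cast_nonneg d
    refine ⟨v ++ [d], b + 1, by simp, hvd, ?_⟩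
    rw [defect_concat, pow_succ]
    rcases ho with ho | ho
    · right
      have := mul_le_mul_of_nonpos_left ho (by linarith : x ≤ 0)
      linarith
    · left
      have := mul_le_mul_of_nonpos_left ho (by linarith : x ≤ 0)
      linarith

theorem defect_unbounded {t : ℕ} {x B : ℝ} (hx : x < -1) (hB : B * (x ^ 2 - 1) = 3) {u : List ℕ}
    {a : ℕ} (hu : u ≠ []) (h : IsStablePrefix t u a 0)
    (hout : B < defect x t u a ∨ defect x t u a < x * B) (K : ℝ) :
    ∃ u a, u ≠ [] ∧ IsStablePrefix t u a 0 ∧ K < |defect x t u a| := by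
  obtain ⟨E, hE, hout⟩ : ∃ E : ℝ, 0 < E ∧
      (B + E ≤ defect x t u a ∨ defect x t u a ≤ x * B - E) := by
    rcases hout with ho | ho
    · exact ⟨_, sub_pos.mpr ho, Or.inl (by linarith)⟩
    · exact ⟨_, sub_pos.mpr ho, Or.inr (by linarith)⟩
  obtain ⟨k, hk⟩ := pow_unbounded_of_one_lt (K / E) (by linarith : 1 < -x)
  rw [div_lt_iff₀ hE] at hk
  have hB0 : 0 < B := by
    by_contra hB0
    nlinarith [mul_nonneg (by linarith : 0 ≤ -1 - x) (by linarith : 0 ≤ 1 - x)]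
  obtain ⟨v, b, hv, hs, ho⟩ := exists_defect_outside hx hB hu h hout k
  refine ⟨v, b, hv, hs, ?_⟩
  rcases ho with ho | ho
  · linarith [le_abs_self (defect x t v b)]
  · have : x * B < 0 := mul_neg_of_neg_of_pos (by linarith) hB0
    linarith [neg_le_abs (defect x t v b)]

/-! ### Prefixes with defect outside the interval -/

theorem abs_baseVal_concat_le {x : ℝ} (hx : |x| ≤ 1.1) {u : List ℕ} {d : ℕ} (hd : d ≤ 3)
    (h : |baseVal x u| ≤ 30 * (1.1 ^ u.length - 1)) :
    |baseVal x (u ++ [d])| ≤ 30 * (1.1 ^ (u ++ [d]).length - 1) := by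
  have hd3 : (d : ℝ) ≤ 3 := by exact_mod_cast hd
  rw [baseVal_concat, List.length_append, List.length_singleton, pow_succ]
  have h1 := abs_add_le (x * baseVal x u) d
  rw [abs_mul, Nat.abs_cast] at h1
  have h2 := mul_le_mul hx h (abs_nonneg _) (by norm_num)
  -- The bound is `3 * (1 + 1.1 + ⋯ + 1.1 ^ (n - 1))` for `n` digits: `1.1 * 30 * (1.1 ^ n - 1) + 3
  -- = 30 * (1.1 ^ (n + 1) - 1)`.
  linarith

theorem IsStablePrefix.extend_all {x : ℝ} (hx : |x| ≤ 1.1) {t b : ℕ} :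
    ∀ {u : List ℕ}, |baseVal x u| ≤ 30 * (1.1 ^ u.length - 1) → IsStablePrefix t u 0 b →
    ∃ v, v.length = u.length + b ∧ |baseVal x v| ≤ 30 * (1.1 ^ v.length - 1) ∧
      IsStablePrefix t v 0 0 := by
  induction b with
  | zero => exact fun {u} h hs => ⟨u, rfl, h, hs⟩
  | succ b ih =>
    intro u h hs
    obtain ⟨d, hd, hs⟩ := hs.extend
    obtain ⟨v, h1, h2, h3⟩ := ih (abs_baseVal_concat_le hx hd h) hs
    refine ⟨v, ?_, h2, h3⟩
    rw [h1, List.length_append, List.length_singleton]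
    ring

/-- The prefix down to the units position has `l + 1` digits, so its value in base `x` is at most
`30 * (1.1 ^ (l + 1) - 1)`. For `l ≤ 3` this is below 14; for `l ≥ 4` it is at most `3 ^ l - 30 ≤ t
- 30`. The threshold 14.9 lies above `B`. -/
theorem exists_defect_gt_of_large {x : ℝ} (hx : |x| ≤ 1.1) {t : ℕ} (ht : 29 ≤ t) :
    ∃ u a, u ≠ [] ∧ IsStablePrefix t u a 0 ∧ 14.9 < defect x t u a := by
  obtain ⟨l, hl, hs⟩ := exists_isStablePrefix_nil (t := t) (by omega)
  obtain ⟨u, h1, h2, h3⟩ := hs.extend_all hx (by simp [baseVal])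
  refine ⟨u, 0, fun h => by simp [h] at h1, h3, ?_⟩
  rw [List.length_nil, zero_add] at h1
  rw [h1] at h2
  have h4 := (abs_le.mp h2).2
  rw [defect, pow_zero, mul_one]
  have ht' : (29 : ℝ) ≤ t := by exact_mod_cast ht
  rcases Nat.lt_or_ge l 4 with h | h
  · have h5 : (1.1 : ℝ) ^ (l + 1) ≤ 1.1 ^ 4 := pow_le_pow_right₀ (by norm_num) (by omega)
    norm_num at h4 h5 ⊢
    linarith
  · have h5 : 30 * (1.1 : ℝ) ^ (l + 1) ≤ 3 ^ l := by
      clear hl hs h1 h2 h4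
      induction l, h using Nat.le_induction with
      | base => norm_num
      | succ k _ ih =>
        rw [pow_succ _ (k + 1), pow_succ (3 : ℝ) k]
        have : (0 : ℝ) < 1.1 ^ (k + 1) := by positivity
        linarith
    have h6 : (3 : ℝ) ^ l ≤ t := by exact_mod_cast hl
    linarith

/-- One Horner step in interval arithmetic: 1.1 bounds `|x|`, and `0.0001 = 0.000005 * 20` pays for
replacing `x` by the midpoint -1.096845. -/
theorem horner_approx {x y c e d c' e' : ℝ} (h1 : -1.09685 < x) (h2 : x < -1.09684)
    (hy : |y - c| ≤ e) (hc : |c| ≤ 20) (hl : c' - e' + 1.1 * e + 0.0001 ≤ -1.096845 * c - d)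
    (hu : -1.096845 * c - d + 1.1 * e + 0.0001 ≤ c' + e') : |x * y - d - c'| ≤ e' := by
  have e1 : |x * (y - c)| ≤ 1.1 * e := by
    rw [abs_mul]
    exact mul_le_mul (abs_le.mpr ⟨by linarith, by linarith⟩) hy (abs_nonneg _) (by norm_num)
  have e2 : |(x + 1.096845) * c| ≤ 0.000005 * 20 := by
    rw [abs_mul]
    exact mul_le_mul (abs_le.mpr ⟨by linarith, by linarith⟩) hc (abs_nonneg _) (by norm_num)
  rw [abs_le] at e1 e2 ⊢
  constructor <;> linarith [e1.1, e1.2, e2.1, e2.2]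

/-- The thresholds lie just outside `[x * B, B]`. In each block of values of `t`, beginning at some
`t₀`, the units digit of the prefix is `t - t₀` and the other digits are fixed. So `t` cancels from
the defect, and one estimate serves the whole block. -/
theorem exists_defect_outside_of_small {x : ℝ} (h1 : -1.09685 < x) (h2 : x < -1.09684) {t : ℕ}
    (ht : 4 ≤ t) (ht' : t < 29) : ∃ u a, u ≠ [] ∧ IsStablePrefix t u a 0 ∧
      (14.9 < defect x t u a ∨ defect x t u a < -16.3) := by
  have hx2 : 1.203050 < x ^ 2 ∧ x ^ 2 < 1.203081 := by constructor <;> nlinarith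
  rcases Nat.lt_or_ge t 8 with hb1 | hb1
  · refine ⟨1 :: [t - 4, 1, 1, 1, 1, 2, 0, 2, 3, 0, 0], 10, by simp, ?_, Or.inl ?_⟩
    · clear h1 h2 hx2
      interval_cases t <;>
        exact isStablePrefix_of_window (by norm_num) 5 (by decide +kernel) (by decide +kernel)
    · obtain ⟨s, rfl⟩ := Nat.exists_eq_add_of_le ht
      simp only [defect, baseVal, List.length_cons, List.length_nil, Nat.add_sub_cancel_left]
      push_cast
      -- The leading digits `1, t - 4` give the defect `4 - x` at `a = 0`; each further digit is one
      -- Horner step.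
      have y0 : |(4 - x) - 5.0968| ≤ 0.0002 := by rw [abs_le]; constructor <;> linarith
      have y1 := horner_approx h1 h2 y0 (d := 1) (c' := -6.5904) (e' := 0.00034) (by norm_num)
        (by norm_num) (by norm_num)
      have y2 := horner_approx h1 h2 y1 (d := 1) (c' := 6.2286) (e' := 0.00054) (by norm_num)
        (by norm_num) (by norm_num)
      have y3 := horner_approx h1 h2 y2 (d := 1) (c' := -7.8318) (e' := 0.00072) (by norm_num)
        (by norm_num) (by norm_num)
      have y4 := horner_approx h1 h2 y3 (d := 1) (c' := 7.5903) (e' := 0.00094) (by norm_num)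
        (by norm_num) (by norm_num)
      have y5 := horner_approx h1 h2 y4 (d := 2) (c' := -10.3254) (e' := 0.00117) (by norm_num)
        (by norm_num) (by norm_num)
      have y6 := horner_approx h1 h2 y5 (d := 0) (c' := 11.3254) (e' := 0.00144) (by norm_num)
        (by norm_num) (by norm_num)
      have y7 := horner_approx h1 h2 y6 (d := 2) (c' := -14.4222) (e' := 0.00171) (by norm_num)
        (by norm_num) (by norm_num)
      have y8 := horner_approx h1 h2 y7 (d := 3) (c' := 12.8189) (e' := 0.00202) (by norm_num)
        (by norm_num) (by norm_num)
      have y9 := horner_approx h1 h2 y8 (d := 0) (c' := -14.0603) (e' := 0.00239) (by norm_num)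
        (by norm_num) (by norm_num)
      have y10 := horner_approx h1 h2 y9 (d := 0) (c' := 15.422) (e' := 0.00278) (by norm_num)
        (by norm_num) (by norm_num)
      linarith [(abs_le.mp y10).1]
  rcases Nat.lt_or_ge t 11 with hb2 | hb2
  · refine ⟨2 :: [t - 8, 2, 2, 2, 3, 0, 2], 6, by simp, ?_, Or.inl ?_⟩
    · clear h1 h2 hx2
      interval_cases t <;>
        exact isStablePrefix_of_window (by norm_num) 5 (by decide +kernel) (by decide +kernel)
    · obtain ⟨s, rfl⟩ := Nat.exists_eq_add_of_le hb1
      simp only [defect, baseVal, List.length_cons, List.length_nil, Nat.add_sub_cancel_left]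
      push_cast
      have y0 : |(8 - 2 * x) - 10.1937| ≤ 0.0002 := by rw [abs_le]; constructor <;> linarith
      have y1 := horner_approx h1 h2 y0 (d := 2) (c' := -13.1809) (e' := 0.00035) (by norm_num)
        (by norm_num) (by norm_num)
      have y2 := horner_approx h1 h2 y1 (d := 2) (c' := 12.4574) (e' := 0.00051) (by norm_num)
        (by norm_num) (by norm_num)
      have y3 := horner_approx h1 h2 y2 (d := 2) (c' := -15.6638) (e' := 0.00072) (by norm_num)
        (by norm_num) (by norm_num)
      have y4 := horner_approx h1 h2 y3 (d := 3) (c' := 14.1808) (e' := 0.00095) (by norm_num)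
        (by norm_num) (by norm_num)
      have y5 := horner_approx h1 h2 y4 (d := 0) (c' := -15.5541) (e' := 0.00120) (by norm_num)
        (by norm_num) (by norm_num)
      have y6 := horner_approx h1 h2 y5 (d := 2) (c' := 15.0604) (e' := 0.00148) (by norm_num)
        (by norm_num) (by norm_num)
      linarith [(abs_le.mp y6).1]
  rcases Nat.lt_or_ge t 14 with hb3 | hb3
  · refine ⟨3 :: [t - 11, 0, 1], 2, by simp, ?_, Or.inl ?_⟩
    · clear h1 h2 hx2
      interval_cases t <;>
        exact isStablePrefix_of_window (by norm_num) 5 (by decide +kernel) (by decide +kernel)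
    · obtain ⟨s, rfl⟩ := Nat.exists_eq_add_of_le hb2
      simp only [defect, baseVal, List.length_cons, List.length_nil, Nat.add_sub_cancel_left]
      push_cast
      have y0 : |(11 - 3 * x) - 14.2905| ≤ 0.0002 := by rw [abs_le]; constructor <;> linarith
      have y1 := horner_approx h1 h2 y0 (d := 0) (c' := -15.6745) (e' := 0.00038) (by norm_num)
        (by norm_num) (by norm_num)
      have y2 := horner_approx h1 h2 y1 (d := 1) (c' := 16.1925) (e' := 0.00054) (by norm_num)
        (by norm_num) (by norm_num)
      linarith [(abs_le.mp y2).1]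
  rcases Nat.lt_or_ge t 17 with hb4 | hb4
  · refine ⟨1 :: [0, t - 14, 3], 1, by simp, ?_, Or.inr ?_⟩
    · clear h1 h2 hx2
      interval_cases t <;>
        exact isStablePrefix_of_window (by norm_num) 5 (by decide +kernel) (by decide +kernel)
    · obtain ⟨s, rfl⟩ := Nat.exists_eq_add_of_le hb3
      simp only [defect, baseVal, List.length_cons, List.length_nil, Nat.add_sub_cancel_left]
      push_cast
      nlinarith [hx2.1, hx2.2]
  rcases Nat.lt_or_ge t 21 with hb5 | hb5
  · refine ⟨1 :: [1, t - 17], 0, by simp, ?_, Or.inl ?_⟩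
    · clear h1 h2 hx2
      interval_cases t <;>
        exact isStablePrefix_of_window (by norm_num) 5 (by decide +kernel) (by decide +kernel)
    · obtain ⟨s, rfl⟩ := Nat.exists_eq_add_of_le hb4
      simp only [defect, baseVal, List.length_cons, List.length_nil, Nat.add_sub_cancel_left]
      push_cast
      nlinarith [hx2.1, hx2.2]
  rcases Nat.lt_or_ge t 24 with hb6 | hb6
  · refine ⟨1 :: [2, t - 21], 0, by simp, ?_, Or.inl ?_⟩
    · clear h1 h2 hx2
      interval_cases t <;>
        exact isStablePrefix_of_window (by norm_num) 5 (by decide +kernel) (by decide +kernel)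
    · obtain ⟨s, rfl⟩ := Nat.exists_eq_add_of_le hb5
      simp only [defect, baseVal, List.length_cons, List.length_nil, Nat.add_sub_cancel_left]
      push_cast
      nlinarith [hx2.1, hx2.2]
  rcases Nat.lt_or_ge t 27 with hb7 | hb7
  · refine ⟨1 :: [3, t - 24], 0, by simp, ?_, Or.inl ?_⟩
    · clear h1 h2 hx2
      interval_cases t <;>
        exact isStablePrefix_of_window (by norm_num) 5 (by decide +kernel) (by decide +kernel)
    · obtain ⟨s, rfl⟩ := Nat.exists_eq_add_of_le hb6
      simp only [defect, baseVal, List.length_cons, List.length_nil, Nat.add_sub_cancel_left]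
      push_cast
      nlinarith [hx2.1, hx2.2]
  refine ⟨2 :: [0, t - 27], 0, by simp, ?_, Or.inl ?_⟩
  · clear h1 h2 hx2
    interval_cases t <;>
      exact isStablePrefix_of_window (by norm_num) 5 (by decide +kernel) (by decide +kernel)
  · obtain ⟨s, rfl⟩ := Nat.exists_eq_add_of_le hb7
    simp only [defect, baseVal, List.length_cons, List.length_nil, Nat.add_sub_cancel_left]
    push_cast
    nlinarith [hx2.1, hx2.2]

/-! ## Automata reading the representations -/

/-- An arbitrary predicate on states covers both acceptance by a DFA and output 1 of an automaton
with output. -/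
theorem not_finite_of_four_le {Q : Type*} [Finite Q] {start : Q} {step : Q → ℕ → Q}
    {acc : Q → Prop} {t : ℕ} (ht : 4 ≤ t)
    (hacc : ∀ n w, IsGreedyWord n w → (acc (w.foldl step start) ↔ ∃ k, n = t * exampleSeq k)) :
    False := by
  obtain ⟨x, hx, h1, h2⟩ := exists_negative_root
  have hx2 : 1.203050 < x ^ 2 ∧ x ^ 2 < 1.203081 := by constructor <;> nlinarith
  have hne : x ^ 2 - 1 ≠ 0 := by linarith [hx2.1]
  have hB : 3 / (x ^ 2 - 1) * (x ^ 2 - 1) = 3 := div_mul_cancel₀ _ hne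
  have hlt : 3 / (x ^ 2 - 1) < 14.78 := by
    rw [div_lt_iff₀ (by linarith [hx2.1])]
    linarith [hx2.1]
  generalize 3 / (x ^ 2 - 1) = B at hB hlt
  have hB0 : 0 < B := by
    by_contra hB0
    nlinarith [hx2.1]
  have hgt : -16.3 < x * B := by nlinarith
  obtain ⟨u, a, hu, hs, ho⟩ : ∃ u a, u ≠ [] ∧ IsStablePrefix t u a 0 ∧
      (B < defect x t u a ∨ defect x t u a < x * B) := by
    rcases Nat.lt_or_ge t 29 with h | h
    · obtain ⟨u, a, hu, hs, ho⟩ := exists_defect_outside_of_small h1 h2 ht h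
      exact ⟨u, a, hu, hs, ho.imp (fun h => by linarith) (fun h => by linarith)⟩
    · obtain ⟨u, a, hu, hs, ho⟩ := exists_defect_gt_of_large
        (abs_le.mpr ⟨by linarith, by linarith⟩ : |x| ≤ 1.1) h
      exact ⟨u, a, hu, hs, Or.inl (by linarith)⟩
  exact not_finite_of_defect_unbounded (by omega) hacc hx (by linarith) (by linarith)
    (defect_unbounded (by linarith) hB hu hs ho)

theorem not_finite_of_rep {Q : Type*} [Finite Q] {start : Q} {step : Q → exampleSystem.Digit → Q}
    {acc : Q → Prop} {t : ℕ} (ht : 4 ≤ t) (hacc : ∀ n,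
      acc ((exampleSystem.rep n).foldl step start) ↔ ∃ k, n = t * exampleSeq k) : False := by
  refine not_finite_of_four_le (start := start) (acc := acc)
    -- Letters outside the alphabet fix the state; they never occur in greedy words.
    (step := fun q d => if h : d < exampleSystem.bound then step q ⟨d, h⟩ else q) ht ?_
  intro n w hw
  rw [hw.eq_map_rep, List.foldl_map, ← hacc n]
  simp

theorem not_isRecognizable_mul {t : ℕ} (ht : 4 ≤ t) :
    ¬ exampleSystem.IsRecognizable {m | ∃ n : ℕ, m = t * exampleSystem.seq n} := by
  rintro ⟨Q, _, M, hM⟩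
  refine not_finite_of_rep (start := M.start) (step := M.step) (acc := (· ∈ M.accept)) ht ?_
  intro n
  have h : exampleSystem.rep n ∈ M.accepts ↔ exampleSystem.rep n ∈
      exampleSystem.repLanguage {m | ∃ n : ℕ, m = t * exampleSystem.seq n} := by rw [hM]
  refine h.trans ⟨?_, fun hn => ⟨n, hn, rfl⟩⟩
  rintro ⟨n', hn', he⟩
  have : n' = n := by
    rw [← (exampleSystem.isGreedyRep_rep n').val_eq, he, (exampleSystem.isGreedyRep_rep n).val_eq]
  exact this ▸ hn'

/-! ### Characteristic sequences, the substitution, and the automaton for `{U n}` -/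

theorem charSeq_eq_one_iff {X : Set ℕ} {n : ℕ} : charSeq X n = 1 ↔ n ∈ X := by
  unfold charSeq
  split_ifs with h <;> simp [h]

theorem not_isAutomatic_mul {t : ℕ} (ht : 4 ≤ t) :
    ¬ IsAutomatic exampleSystem (charSeq {m | ∃ n : ℕ, m = t * exampleSystem.seq n}) := by
  rintro ⟨Q, _, M, -, hM⟩
  refine not_finite_of_rep (start := M.start) (step := M.step) (acc := fun q => M.output q = 1)
    ht ?_
  intro n
  rw [← DFAO.eval, ← hM, charSeq_eq_one_iff]
  rfl

theorem substImage_spread {X : ℕ → ℕ} {t : ℕ} (ht : 0 < t) :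
    substImage ht (spread t) (charSeq {m | ∃ n : ℕ, m = X n}) =
      charSeq {m | ∃ n : ℕ, m = t * X n} := by
  funext n
  have h : ∀ a b : Fin 2, (a = 1 ↔ b = 1) → a = b := by decide
  apply h
  rw [charSeq_eq_one_iff, substImage, spread]
  simp only [charSeq_eq_one_iff, Set.mem_ofPred_eq, ite_eq_left_iff, zero_ne_one, imp_false,
    not_not]
  constructor
  · rintro ⟨⟨k, hk⟩, hn⟩
    refine ⟨k, ?_⟩
    rw [← hk]
    exact (Nat.mul_div_cancel' (Nat.dvd_of_mod_eq_zero hn)).symm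
  · rintro ⟨k, rfl⟩
    exact ⟨⟨k, Nat.mul_div_cancel_left _ ht⟩, Nat.mul_mod_right _ _⟩

/-- The automaton with states `0, 1, 2` that outputs `1` on the words of `0* 1 0*`. -/
def oneDigitAutomaton (A : Type) (v : A → ℕ) : DFAO A (Fin 3) (Fin 2) where
  start := 0
  step q a := if v a = 0 then q else if v a = 1 ∧ q = 0 then 1 else 2
  output q := if q = 1 then 1 else 0

theorem oneDigitAutomaton_foldl_two {A : Type} (v : A → ℕ) (w : List A) :
    w.foldl (oneDigitAutomaton A v).step 2 = 2 := by
  induction w with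
  | nil => rfl
  | cons a w ih =>
    rw [List.foldl_cons]
    have : (oneDigitAutomaton A v).step 2 a = 2 := by simp [oneDigitAutomaton]
    rw [this, ih]

theorem oneDigitAutomaton_foldl_one {A : Type} (v : A → ℕ) (w : List A) :
    w.foldl (oneDigitAutomaton A v).step 1 = 1 ↔ ∀ a ∈ w, v a = 0 := by
  induction w with
  | nil => simp
  | cons a w ih =>
    rw [List.foldl_cons, List.forall_mem_cons]
    by_cases h : v a = 0
    · have : (oneDigitAutomaton A v).step 1 a = 1 := by simp [oneDigitAutomaton, h]
      simp only [this, ih, h, true_and]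
    · have : (oneDigitAutomaton A v).step 1 a = 2 := by simp [oneDigitAutomaton, h]
      rw [this, oneDigitAutomaton_foldl_two]
      simp [h]

theorem NumerationSystem.val_eq_zero {S : NumerationSystem} {w : List S.Digit} :
    S.val w = 0 ↔ ∀ d ∈ w, (d : ℕ) = 0 := by
  induction w with
  | nil => simp [val]
  | cons d w ih =>
    have := (S.seq_pos w.length).ne'
    simp only [val, Nat.add_eq_zero_iff, ih, List.forall_mem_cons, mul_eq_zero, this, or_false]

/-- The characteristic sequence of `{U n}` is automatic. -/
theorem NumerationSystem.isAutomatic_charSeq_range (S : NumerationSystem) :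
    IsAutomatic S (charSeq {m | ∃ n : ℕ, m = S.seq n}) := by
  refine ⟨Fin 3, inferInstance, oneDigitAutomaton S.Digit (fun d => (d : ℕ)), fun a ha => ?_,
    fun n => ?_⟩
  · simp [oneDigitAutomaton, ha]
  have h : ∀ a b : Fin 2, (a = 1 ↔ b = 1) → a = b := by decide
  apply h
  rw [charSeq_eq_one_iff]
  obtain ⟨h1, h2, h3⟩ := S.isGreedyRep_rep n
  generalize S.rep n = w at h1 h2 h3
  have hout : ∀ q : Fin 3, (oneDigitAutomaton S.Digit fun d => (d : ℕ)).output q = 1 ↔ q = 1 := by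
    intro q
    simp [oneDigitAutomaton]
  rw [DFAO.eval, hout, Set.mem_ofPred_eq, ← h1]
  cases w with
  | nil =>
    refine ⟨?_, fun h => absurd h (by simp [oneDigitAutomaton])⟩
    rintro ⟨k, hk⟩
    exact absurd hk (S.seq_pos k).ne
  | cons d w =>
    have hd0 := h2 d (by simp)
    have hw := h3 w (List.suffix_cons d w)
    have hdw := h3 (d :: w) List.suffix_rfl
    rw [List.foldl_cons]
    by_cases hd : (d : ℕ) = 1
    · have e : (oneDigitAutomaton S.Digit fun d => (d : ℕ)).step
          (oneDigitAutomaton S.Digit fun d => (d : ℕ)).start d = 1 := by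
        simp [oneDigitAutomaton, hd]
      rw [e, oneDigitAutomaton_foldl_one, ← NumerationSystem.val_eq_zero]
      simp only [NumerationSystem.val, hd, one_mul] at hdw ⊢
      constructor
      · rintro ⟨k, hk⟩
        -- The value is below `U (|w| + 1)`, so `k ≤ |w|`; as the leading digit already contributes
        -- `U |w|`, the rest has value 0.
        have hk1 : S.seq k < S.seq (w.length + 1) := hk ▸ hdw
        have hk2 := S.strictMono_seq.monotone (Nat.le_of_lt_succ (S.strictMono_seq.lt_iff_lt.mp hk1))
        omega
      · exact fun h => ⟨w.length, by omega⟩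
    · have e : (oneDigitAutomaton S.Digit fun d => (d : ℕ)).step
          (oneDigitAutomaton S.Digit fun d => (d : ℕ)).start d = 2 := by
        simp [oneDigitAutomaton, hd, hd0]
      rw [e, oneDigitAutomaton_foldl_two]
      simp only [NumerationSystem.val] at hdw ⊢
      refine ⟨?_, fun h => absurd h (by decide)⟩
      rintro ⟨k, hk⟩
      have hk1 : S.seq k < S.seq (w.length + 1) := hk ▸ hdw
      have hk2 := S.strictMono_seq.monotone (Nat.le_of_lt_succ (S.strictMono_seq.lt_iff_lt.mp hk1))
      have hp := S.seq_pos w.length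
      have : 2 * S.seq w.length ≤ d * S.seq w.length := Nat.mul_le_mul_right _ (by omega)
      omega

theorem not_closedUnderSubst_spread {t : ℕ} (ht : 4 ≤ t) (h0 : 0 < t) :
    ¬ ClosedUnderSubst exampleSystem h0 (spread t) := by
  intro h
  have h1 := h _ exampleSystem.isAutomatic_charSeq_range
  rw [substImage_spread] at h1
  exact not_isAutomatic_mul ht h1

theorem mainTheorem3 :
    -- `U` is a Parry numeration system, `U = U_β` for exactly one `β > 1`; this `β` is a Parry
    -- number with `d_β(1) = 3203`, and it is not a Pisot number.
    IsParrySystem exampleSystem ∧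
    (∃ β : ℝ, IsParryNumber β ∧ IsCanonicalSystem β exampleSystem ∧
      (∀ β' : ℝ, 1 < β' → IsCanonicalSystem β' exampleSystem → β' = β) ∧
      |β - 3.61645| < 0.00001 ∧
      IsBetaExpansion β 1 expansion3203 ∧
      ¬ IsPisotNumber β) ∧
    -- The characteristic sequence of `{U_n}` is `U`-automatic.
    IsAutomatic exampleSystem (charSeq {m | ∃ n : ℕ, m = exampleSystem.seq n}) ∧
    -- For `t ≥ 4`, the set `{t U_n}` is not `U`-recognizable; its characteristic sequence is the
    -- image of that of `{U_n}` under `0 ↦ 0^t, 1 ↦ 1 0^(t-1)`, and is not `U`-automatic; so the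
    -- `U`-automatic sequences are not closed under this substitution.
    (∀ (t : ℕ) (ht : 4 ≤ t),
      ¬ exampleSystem.IsRecognizable {m | ∃ n : ℕ, m = t * exampleSystem.seq n} ∧
      substImage (lt_of_lt_of_le (by norm_num) ht) (spread t)
          (charSeq {m | ∃ n : ℕ, m = exampleSystem.seq n}) =
        charSeq {m | ∃ n : ℕ, m = t * exampleSystem.seq n} ∧
      ¬ IsAutomatic exampleSystem (charSeq {m | ∃ n : ℕ, m = t * exampleSystem.seq n}) ∧
      ¬ ClosedUnderSubst exampleSystem (lt_of_lt_of_le (by norm_num) ht) (spread t)) ∧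
    -- There is a Parry numeration system whose automatic sequences are not closed under taking
    -- images by uniform substitutions.
    (∃ S : NumerationSystem, IsParrySystem S ∧ ¬ ClosedUnderUniformSubst S) := by
  obtain ⟨β, hβ, h1, h2⟩ := exists_dominant_root
  have h3 : 3 < β := by linarith
  have hP := isParryNumber_of_isCharRoot hβ h3
  have hC := isCanonicalSystem_of_isCharRoot hβ h3
  refine ⟨⟨β, hP, hC⟩, ⟨β, hP, hC, fun β' h h' => hC.base_unique hP.1 h h', ?_,
    isBetaExpansion_expansion3203 hβ h3, hβ.not_isPisotNumber hP.1⟩,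
    exampleSystem.isAutomatic_charSeq_range, fun t ht => ⟨not_isRecognizable_mul ht,
    substImage_spread _, not_isAutomatic_mul ht, not_closedUnderSubst_spread ht _⟩,
    exampleSystem, ⟨β, hP, hC⟩, fun h => ?_⟩
  · rw [abs_lt]
    constructor <;> linarith
  · exact not_closedUnderSubst_spread (t := 4) le_rfl (by norm_num)
      (h (Fin 2) (Fin 2) 4 (by norm_num) (spread 4))
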